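/- Let $k$ be an arbitrary field and let $$A=k\langle x,y,z\mid x^2+yx,\ xz,\ zy\rangle$$ be the quotient of the free associative algebra on $x,y,z$ by the two-sided ideal generated by $x^2+yx$, $xz$ and $zy$, graded by $\deg x=\deg y=\deg z=1$. Recall that a graded algebra $B=\bigoplus_{n\ge 0}B_n$ over $k$ with $B_0=k$ is called Koszul if its bar homology $\operatorname{Tor}^B(k,k)$ is concentrated on the diagonal, that is, if $\operatorname{Tor}^B_i(k,k)_j=0$ whenever the homological degree $i$ differs from the internal degree $j$. Then: 1. $A$ is Koszul; 2. the global dimension of $A$ (the supremum of the projective dimensions of all $A$-modules) is equal to $4$, both for left and for right modules; 3. $\dim_k A_1=3$. Hence Positselski's conjecture, that every Koszul algebra $B$ (with $B_1$ finite-dimensional) of finite global dimension $d$ satisfies $\dim_k B_1\ge d$, fails over every field $k$. -/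

import Mathlib

open scoped TensorProduct DirectSum

universe u

noncomputable section

/-! ### Global dimension -/

/-- The left global dimension of a ring: the supremum of the projective dimensions of all
left modules. -/
def leftGlobalDimension (R : Type u) [Ring R] : WithBot ℕ∞ :=
  ⨆ M : ModuleCat.{u} R, CategoryTheory.projectiveDimension M

/-- The right global dimension of a ring: the supremum of the projective dimensions of all
right modules (a right `R`-module is a left module over the opposite ring). -/
def rightGlobalDimension (R : Type u) [Ring R] : WithBot ℕ∞ :=
  leftGlobalDimension Rᵐᵒᵖ

/-! ### Bar homology and Koszul algebras -/

section Bar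

variable {k A : Type u} [Field k] [Ring A] [Algebra k A]

/-- Contracting two neighbours in a tuple is linear in each entry. -/
lemma contractNth_update (k : Type u) {A : Type u} [Field k] [Ring A] [Algebra k A] {n : ℕ}
    (i : Fin n) (a : Fin (n + 1) → A) (j : Fin (n + 1)) :
    ∃ (l : Fin n) (L : A →ₗ[k] A), ∀ v : A,
      Fin.contractNth i.castSucc (· * ·) (Function.update a j v) =
        Function.update (Fin.contractNth i.castSucc (· * ·) a) l (L v) := by
  rcases lt_trichotomy j i.castSucc with h | h | h
  · refine ⟨⟨j, by have := Fin.lt_def.1 h; simp at this; omega⟩, LinearMap.id, fun v => ?_⟩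
    have := Fin.lt_def.1 h
    ext l
    simp only [Fin.contractNth, Function.update_apply, Fin.ext_iff, LinearMap.id_apply]
    simp at this ⊢
    grind
  · refine ⟨i, LinearMap.mulRight k (a i.succ), fun v => ?_⟩
    subst h
    ext l
    simp only [Fin.contractNth, Function.update_apply, Fin.ext_iff, LinearMap.mulRight_apply]
    simp
    grind
  · by_cases h' : j = i.succ
    · refine ⟨i, LinearMap.mulLeft k (a i.castSucc), fun v => ?_⟩
      subst h'
      ext l
      simp only [Fin.contractNth, Function.update_apply, Fin.ext_iff, LinearMap.mulLeft_apply]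
      simp
      grind
    · refine ⟨⟨j - 1, by have := Fin.lt_def.1 h; simp at this; omega⟩, LinearMap.id, fun v => ?_⟩
      have := Fin.lt_def.1 h
      rw [Fin.ext_iff] at h'
      ext l
      simp only [Fin.contractNth, Function.update_apply, Fin.ext_iff, LinearMap.id_apply]
      simp at this h' ⊢
      grind

/-- The multilinear map `(a₀, …, aₙ) ↦ a₀ ⊗ … ⊗ aᵢ aᵢ₊₁ ⊗ … ⊗ aₙ`. -/
def barFaceMultilinear (k A : Type u) [Field k] [Ring A] [Algebra k A] (n : ℕ) (i : Fin n) :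
    MultilinearMap k (fun _ : Fin (n + 1) => A) (⨂[k]^n A) where
  toFun a := PiTensorProduct.tprod k (Fin.contractNth i.castSucc (· * ·) a)
  map_update_add' := by
    intro inst a j x y
    rw [Subsingleton.elim inst (instDecidableEqFin (n + 1))]
    obtain ⟨l, L, h⟩ := contractNth_update k i a j
    simp only [h, map_add, MultilinearMap.map_update_add]
  map_update_smul' := by
    intro inst a j c x
    rw [Subsingleton.elim inst (instDecidableEqFin (n + 1))]
    obtain ⟨l, L, h⟩ := contractNth_update k i a j
    simp only [h, map_smul, MultilinearMap.map_update_smul]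

/-- The bar differential
`d (a₀ ⊗ … ⊗ aₙ) = ∑ i < n, (-1) ^ i • (a₀ ⊗ … ⊗ aᵢ aᵢ₊₁ ⊗ … ⊗ aₙ)`; it vanishes for `n = 0`. -/
def barDifferential (k A : Type u) [Field k] [Ring A] [Algebra k A] (n : ℕ) :
    (⨂[k]^(n + 1) A) →ₗ[k] (⨂[k]^n A) :=
  ∑ i : Fin n, (-1 : k) ^ (i : ℕ) • PiTensorProduct.lift (barFaceMultilinear k A n i)

/-- The component of homological degree `n` and internal degree `j` of the reduced bar complex
of a connected graded algebra: the part of internal degree `j` of `A₊ ⊗ … ⊗ A₊` (`n` factors),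
where `A₊ = A₁ ⊕ A₂ ⊕ …`, viewed inside `A ⊗ … ⊗ A`. -/
def barChains (𝒜 : ℕ → Submodule k A) (n j : ℕ) : Submodule k (⨂[k]^n A) :=
  Submodule.span k
    {t | ∃ (p : Fin n → ℕ) (a : Fin n → A), (∀ i, 1 ≤ p i) ∧ ∑ i, p i = j ∧
      (∀ i, a i ∈ 𝒜 (p i)) ∧ t = PiTensorProduct.tprod k a}

/-- Cycles of the reduced bar complex. -/
def barCycles (𝒜 : ℕ → Submodule k A) : (n j : ℕ) → Submodule k (⨂[k]^n A)
  | 0, j => barChains 𝒜 0 j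
  | n + 1, j => barChains 𝒜 (n + 1) j ⊓ LinearMap.ker (barDifferential k A n)

/-- Boundaries of the reduced bar complex. -/
def barBoundaries (𝒜 : ℕ → Submodule k A) (n j : ℕ) : Submodule k (⨂[k]^n A) :=
  (barChains 𝒜 (n + 1) j).map (barDifferential k A n)

/-- The bar homology of a connected graded algebra, that is, the component of homological
degree `n` and internal degree `j` of `Tor^A(k, k)`. -/
abbrev BarHomology (𝒜 : ℕ → Submodule k A) (n j : ℕ) : Type u :=
  ↥(barCycles 𝒜 n j) ⧸ (barBoundaries 𝒜 n j).comap (barCycles 𝒜 n j).subtype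

/-- A graded `k`-algebra `A` is Koszul if it is connected, i.e. `A₀ = k`, and its bar homology
`Tor^A(k, k)` is concentrated on the diagonal. -/
structure IsKoszul (𝒜 : ℕ → Submodule k A) [GradedAlgebra 𝒜] : Prop where
  nontrivial : Nontrivial A
  connected : 𝒜 0 = 1
  diagonal : ∀ n j : ℕ, n ≠ j → Subsingleton (BarHomology 𝒜 n j)

end Bar

/-- Positselski's conjecture over the field `k`: a Koszul algebra `A` (with `A₁`
finite-dimensional) of finite global dimension `d` satisfies `dim A₁ ≥ d`. -/
def PositselskiConjecture (k : Type u) [Field k] : Prop :=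
  ∀ (A : Type u) [Ring A] [Algebra k A] (𝒜 : ℕ → Submodule k A) [GradedAlgebra 𝒜],
    IsKoszul 𝒜 → Module.Finite k (𝒜 1) →
    ∀ d : ℕ, leftGlobalDimension A = d → rightGlobalDimension A = d →
      d ≤ Module.finrank k (𝒜 1)

/-! ### The algebra `k⟨x, y, z ∣ x² + yx, xz, zy⟩` -/

/-- The three defining relations, with `x`, `y`, `z` the free generators `0`, `1`, `2`. -/
inductive AlgRel (k : Type u) [Field k] :
    FreeAlgebra k (Fin 3) → FreeAlgebra k (Fin 3) → Prop
  | xx_add_yx : AlgRel k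
      (FreeAlgebra.ι k 0 * FreeAlgebra.ι k 0 + FreeAlgebra.ι k 1 * FreeAlgebra.ι k 0) 0
  | xz : AlgRel k (FreeAlgebra.ι k 0 * FreeAlgebra.ι k 2) 0
  | zy : AlgRel k (FreeAlgebra.ι k 2 * FreeAlgebra.ι k 1) 0

/-- The algebra `k⟨x, y, z ∣ x² + yx, xz, zy⟩`. -/
abbrev Alg (k : Type u) [Field k] : Type u := RingQuot (AlgRel k)

namespace Alg

variable (k : Type u) [Field k]

/-- The classes of the generators `x`, `y`, `z` (for `0`, `1`, `2`). -/
def gen (i : Fin 3) : Alg k := RingQuot.mkAlgHom k (AlgRel k) (FreeAlgebra.ι k i)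

lemma gen_xx_add_yx : gen k 0 * gen k 0 + gen k 1 * gen k 0 = 0 := by
  simpa [gen] using RingQuot.mkAlgHom_rel k (AlgRel.xx_add_yx (k := k))

lemma gen_xz : gen k 0 * gen k 2 = 0 := by
  simpa [gen] using RingQuot.mkAlgHom_rel k (AlgRel.xz (k := k))

lemma gen_zy : gen k 2 * gen k 1 = 0 := by
  simpa [gen] using RingQuot.mkAlgHom_rel k (AlgRel.zy (k := k))

/-- The grading with `x`, `y`, `z` in degree `1`: the component of degree `n` is spanned by the
products of `n` generators. -/
def grading (n : ℕ) : Submodule k (Alg k) := Submodule.span k (Set.range (gen k)) ^ n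

lemma gen_mem (i : Fin 3) : gen k i ∈ grading k 1 := by
  rw [grading, pow_one]
  exact Submodule.subset_span ⟨i, rfl⟩

instance : SetLike.GradedMonoid (grading k) :=
  Submodule.nat_power_gradedMonoid (Submodule.span k (Set.range (gen k)))

/-- A generator, as a homogeneous element of degree `1`. -/
def genHom (i : Fin 3) : ⨁ n, grading k n :=
  DirectSum.of (fun n => grading k n) 1 ⟨gen k i, gen_mem k i⟩

lemma genHom_mul (i j : Fin 3) : genHom k i * genHom k j =
    DirectSum.of (fun n => grading k n) 2
      ⟨gen k i * gen k j, SetLike.mul_mem_graded (gen_mem k i) (gen_mem k j)⟩ := by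
  rw [genHom, genHom, DirectSum.of_mul_of]
  rfl

/-- The decomposition of an element into its homogeneous components. -/
def decomposeHom : Alg k →ₐ[k] ⨁ n, grading k n :=
  RingQuot.liftAlgHom k ⟨FreeAlgebra.lift k (genHom k), by
    intro a b h
    cases h with
    | xx_add_yx =>
      simp only [map_add, map_mul, FreeAlgebra.lift_ι_apply, map_zero, genHom_mul]
      rw [← map_add]
      rw [← map_zero (DirectSum.of (fun n => grading k n) 2)]
      exact congrArg _ (Subtype.ext (gen_xx_add_yx k))
    | xz =>
      simp only [map_mul, FreeAlgebra.lift_ι_apply, map_zero, genHom_mul]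
      rw [← map_zero (DirectSum.of (fun n => grading k n) 2)]
      exact congrArg _ (Subtype.ext (gen_xz k))
    | zy =>
      simp only [map_mul, FreeAlgebra.lift_ι_apply, map_zero, genHom_mul]
      rw [← map_zero (DirectSum.of (fun n => grading k n) 2)]
      exact congrArg _ (Subtype.ext (gen_zy k))⟩

lemma decomposeHom_gen (i : Fin 3) : decomposeHom k (gen k i) = genHom k i := by
  simp [decomposeHom, gen]

lemma decomposeHom_of_mem_span (m : Alg k) (hm : m ∈ Submodule.span k (Set.range (gen k))) :
    decomposeHom k m =
      DirectSum.of (fun n => grading k n) 1 ⟨m, by rwa [grading, pow_one]⟩ := by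
  induction hm using Submodule.span_induction with
  | mem x hx =>
    obtain ⟨i, rfl⟩ := hx
    exact decomposeHom_gen k i
  | zero => rw [map_zero]; exact (map_zero (DirectSum.of (fun n => grading k n) 1)).symm
  | add x y hx hy ihx ihy => rw [map_add, ihx, ihy, ← map_add]; rfl
  | smul c x hx ih =>
    rw [map_smul, ih]
    exact (map_smul (DirectSum.lof k ℕ (fun n => grading k n) 1) c _).symm

instance gradedAlgebra : GradedAlgebra (grading k) :=
  GradedAlgebra.ofAlgHom _ (decomposeHom k)
    (by
      refine RingQuot.ringQuot_ext' k _ _ (FreeAlgebra.hom_ext (funext fun i => ?_))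
      change DirectSum.coeAlgHom (grading k) (decomposeHom k (gen k i)) = gen k i
      rw [decomposeHom_gen, genHom, DirectSum.coeAlgHom_of])
    (by
      rintro n ⟨x, hxn⟩
      change decomposeHom k x = DirectSum.of (fun n => grading k n) n ⟨x, hxn⟩
      induction hxn using Submodule.pow_induction_on_left' with
      | algebraMap r => rw [AlgHom.commutes, DirectSum.algebraMap_apply]; rfl
      | add x y i hx hy ihx ihy => rw [map_add, ihx, ihy, ← map_add]; rfl
      | mem_mul m hm i x hx ih =>
        rw [map_mul, ih, decomposeHom_of_mem_span k m hm, DirectSum.of_mul_of]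
        exact DirectSum.of_eq_of_gradedMonoid_eq (Sigma.subtype_ext (add_comm _ _) rfl))

end Alg

end

/-! Everything rests on a chain of left annihilators. Put `b, c, d = x, z, y` and `a = x + y`. Then
`ab = bc = cd = 0`; moreover `Ra` is free, `Ra`, `Rb`, `Rc` are exactly the left annihilators of
`b`, `c`, `d`, and the augmentation ideal is `Rb ⊕ Rc ⊕ Rd`. Up to shifts, `Rd ≅ R/Rc`, `Rc ≅ R/Rb`,
`Rb ≅ R/Ra` and `Ra ≅ R`, so splicing gives `k` a linear free resolution with ranks 1, 3, 3, 2, 1.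
The chain has four members but needs only three generators, because `a` is a combination of `b, c,
d`; this is how the global dimension exceeds `dim A₁`. The opposite algebra has the same shape, with
`b, c, d = z, x, x + y` and `a = y`.

Global dimension: the same data give a complex of modules `R ⊗ M` resolving an arbitrary module `M`.
Its exactness follows by induction on the degree of the left factor (`exists_d₃_eq_of_mem_filt`,
`exists_d₂_eq_of_mem_filt`, `exists_d₁_eq`), which bounds the dimension by 4; the trivial module
attains the bound (`not_hasProjectiveDimensionLT_four`).

Koszulness: off-diagonal bar cycles are filled directly, moving along `a, b, c, d` and working on
the last tensor factor (`multipleCyclesBound`, `exists_barDifferential_eq`).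

The annihilators themselves are computed from a basis of normal words for the relations `bc = 0`,
`cd = 0`, `db = l • eb` (`expand_mon`, `span_normal`, `span_sup_range`, `divAnn_mul`). -/

set_option linter.unusedSectionVars false

/-! ### Annihilator chains and the associated complex of length four. -/

/-- A connected algebra `R` whose augmentation ideal is the direct sum of the left ideals
`R b`, `R c`, `R d`, such that `R a` is free and `R a`, `R b`, `R c` are the left annihilators of
`b`, `c`, `d`, where `a` is a combination of `b`, `c`, `d`. These properties are recorded by linear
maps `Da`, `Db`, `Dc`, `Dd` dividing by `a`, `b`, `c`, `d` from the right. -/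
structure AnnihilatorChain (k R : Type*) [Field k] [Ring R] [Algebra k R] where
  (a b c d : R)
  (β γ δ : k)
  (Da Db Dc Dd : R →ₗ[k] R)
  ε : R →ₐ[k] k
  W : Submodule k R
  a_eq : a = β • b + γ • c + δ • d
  ab : a * b = 0
  bc : b * c = 0
  cd : c * d = 0
  b_mem : b ∈ W
  c_mem : c ∈ W
  d_mem : d ∈ W
  ε_mem : ∀ w ∈ W, ε w = 0
  iSup_pow : ⨆ n : ℕ, W ^ n = ⊤
  Da_one : Da 1 = 0
  Db_one : Db 1 = 0
  Dc_one : Dc 1 = 0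
  Dd_one : Dd 1 = 0
  Da_pow : ∀ n : ℕ, ∀ r ∈ W ^ (n + 1), Da r ∈ W ^ n
  Db_pow : ∀ n : ℕ, ∀ r ∈ W ^ (n + 1), Db r ∈ W ^ n
  Dc_pow : ∀ n : ℕ, ∀ r ∈ W ^ (n + 1), Dc r ∈ W ^ n
  Dd_pow : ∀ n : ℕ, ∀ r ∈ W ^ (n + 1), Dd r ∈ W ^ n
  decomp : ∀ r, r = algebraMap k R (ε r) + Db r * b + Dc r * c + Dd r * d
  Db_c : ∀ r, Db (r * c) = 0
  Db_d : ∀ r, Db (r * d) = 0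
  Dc_b : ∀ r, Dc (r * b) = 0
  Dc_d : ∀ r, Dc (r * d) = 0
  Dd_b : ∀ r, Dd (r * b) = 0
  Dd_c : ∀ r, Dd (r * c) = 0
  Da_a : ∀ r, Da (r * a) = r
  -- This encodes that the left annihilator of `b` is `R a`: if `r * b = 0`, it reads `r = Da r *
  -- a`. The next two fields do the same for `c` and `d`.
  Db_b : ∀ r, r - Db (r * b) = Da (r - Db (r * b)) * a
  Dc_c : ∀ r, r - Dc (r * c) = Db (r - Dc (r * c)) * b
  Dd_d : ∀ r, r - Dd (r * d) = Dc (r - Dd (r * d)) * c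

namespace AnnihilatorChain

section TensorOperators

variable (k : Type*) {R : Type*} (M : Type*) [Field k] [Ring R] [Algebra k R] [AddCommGroup M]
  [Module k M] [Module R M] [IsScalarTower k R M]

/-- Right multiplication on the first factor of `R ⊗ M`. -/
noncomputable def rmul (v : R) : R ⊗[k] M →ₗ[R] R ⊗[k] M :=
  TensorProduct.AlgebraTensorModule.map (LinearMap.toSpanSingleton R R v) LinearMap.id

/-- The action on the second factor of `R ⊗ M`. -/
noncomputable def act (v : R) : R ⊗[k] M →ₗ[R] R ⊗[k] M :=
  TensorProduct.AlgebraTensorModule.map LinearMap.id (Algebra.lsmul k k M v)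

/-- The action `R ⊗ M → M`. -/
noncomputable def aug : R ⊗[k] M →ₗ[R] M :=
  TensorProduct.AlgebraTensorModule.lift
    (LinearMap.toSpanSingleton R (M →ₗ[k] M) LinearMap.id)

variable {k M}

@[simp] lemma rmul_tmul (v r : R) (m : M) : rmul k M v (r ⊗ₜ m) = (r * v) ⊗ₜ m := rfl

@[simp] lemma act_tmul (v r : R) (m : M) : act k M v (r ⊗ₜ m) = r ⊗ₜ[k] (v • m) := rfl

@[simp] lemma aug_tmul (r : R) (m : M) : aug k M (r ⊗ₜ m) = r • m := rfl

lemma rmul_rmul (u v : R) (t : R ⊗[k] M) : rmul k M v (rmul k M u t) = rmul k M (u * v) t := by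
  induction t with
  | zero => simp
  | add s t hs ht => simp only [map_add, hs, ht]
  | tmul r m => simp [mul_assoc]

lemma act_act (u v : R) (t : R ⊗[k] M) : act k M u (act k M v t) = act k M (u * v) t := by
  induction t with
  | zero => simp
  | add s t hs ht => simp only [map_add, hs, ht]
  | tmul r m => simp [mul_smul]

lemma act_rmul (u v : R) (t : R ⊗[k] M) :
    act k M u (rmul k M v t) = rmul k M v (act k M u t) := by
  induction t with
  | zero => simp
  | add s t hs ht => simp only [map_add, hs, ht]
  | tmul r m => simp

lemma aug_rmul (v : R) (t : R ⊗[k] M) : aug k M (rmul k M v t) = aug k M (act k M v t) := by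
  induction t with
  | zero => simp
  | add s t hs ht => simp only [map_add, hs, ht]
  | tmul r m => simp [mul_smul]

lemma act_rTensor (v : R) (D : R →ₗ[k] R) (t : R ⊗[k] M) :
    act k M v (D.rTensor M t) = D.rTensor M (act k M v t) := by
  induction t with
  | zero => simp
  | add s t hs ht => simp only [map_add, hs, ht]
  | tmul r m => simp

lemma rmul_comb (u v w : R) (x y z : k) (t : R ⊗[k] M) :
    rmul k M (x • u + y • v + z • w) t =
      x • rmul k M u t + y • rmul k M v t + z • rmul k M w t := by
  induction t with
  | zero => simp
  | add s t hs ht => simp only [map_add, hs, ht, smul_add]; abel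
  | tmul r m => simp [mul_add, TensorProduct.add_tmul, TensorProduct.smul_tmul']

lemma act_comb (u v w : R) (x y z : k) (t : R ⊗[k] M) :
    act k M (x • u + y • v + z • w) t =
      x • act k M u t + y • act k M v t + z • act k M w t := by
  induction t with
  | zero => simp
  | add s t hs ht => simp only [map_add, hs, ht, smul_add]; abel
  | tmul r m => simp [add_smul, TensorProduct.tmul_add]

lemma rmul_zero (t : R ⊗[k] M) : rmul k M (0 : R) t = 0 := by
  induction t with
  | zero => simp
  | add s t hs ht => simp only [map_add, hs, ht, add_zero]
  | tmul r m => simp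

lemma act_zero (t : R ⊗[k] M) : act k M (0 : R) t = 0 := by
  induction t with
  | zero => simp
  | add s t hs ht => simp only [map_add, hs, ht, add_zero]
  | tmul r m => simp

lemma rmul_smul (v : R) (x : k) (t : R ⊗[k] M) :
    rmul k M v (x • t) = x • rmul k M v t := by
  simp

lemma act_smul (v : R) (x : k) (t : R ⊗[k] M) :
    act k M v (x • t) = x • act k M v t := by
  simp

end TensorOperators

variable {k R : Type*} [Field k] [Ring R] [Algebra k R] (C : AnnihilatorChain k R)

lemma a_mem : C.a ∈ C.W := by
  rw [C.a_eq]
  exact add_mem (add_mem (C.W.smul_mem _ C.b_mem) (C.W.smul_mem _ C.c_mem))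
    (C.W.smul_mem _ C.d_mem)

section Complex

variable (M : Type*) [AddCommGroup M] [Module k M] [Module R M] [IsScalarTower k R M]

/-- The span of the tensors `r ⊗ m` with `r` homogeneous of degree less than `n`. -/
def filt (n : ℕ) : Submodule k (R ⊗[k] M) :=
  Submodule.span k {t | ∃ i < n, ∃ r ∈ C.W ^ i, ∃ m : M, t = r ⊗ₜ m}

/-- The first differential `(R ⊗ M)³ → R ⊗ M`. -/
noncomputable def d₁ : ((R ⊗[k] M) × (R ⊗[k] M) × (R ⊗[k] M)) →ₗ[R] R ⊗[k] M :=
  (rmul k M C.b - act k M C.b).coprod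
    ((rmul k M C.c - act k M C.c).coprod (rmul k M C.d - act k M C.d))

/-- The second differential `(R ⊗ M)³ → (R ⊗ M)³`. -/
noncomputable def d₂ : ((R ⊗[k] M) × (R ⊗[k] M) × (R ⊗[k] M)) →ₗ[R]
    ((R ⊗[k] M) × (R ⊗[k] M) × (R ⊗[k] M)) :=
  -- The summands belong to the relations `ab`, `bc`, `cd`. The relation `uv` contributes `u[v] +
  -- [u]v`, and `[a]` expands as `β[b] + γ[c] + δ[d]`, so the first summand reaches all three
  -- components.
  ((rmul k M C.a + act k M (C.β • C.b)).prod
    ((act k M (C.γ • C.b)).prod (act k M (C.δ • C.b)))).coprod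
  (((act k M C.c).prod ((rmul k M C.b).prod 0)).coprod
    ((0 : R ⊗[k] M →ₗ[R] R ⊗[k] M).prod ((act k M C.d).prod (rmul k M C.c))))

/-- The third differential `(R ⊗ M)² → (R ⊗ M)³`. -/
noncomputable def d₃ : ((R ⊗[k] M) × (R ⊗[k] M)) →ₗ[R]
    ((R ⊗[k] M) × (R ⊗[k] M) × (R ⊗[k] M)) :=
  -- The summands belong to `abc` and `bcd`: the first letter multiplies into `R`, the last acts on
  -- `M` with a minus sign.
  ((-act k M C.c).prod ((rmul k M C.a).prod 0)).coprod
    ((0 : R ⊗[k] M →ₗ[R] R ⊗[k] M).prod ((-act k M C.d).prod (rmul k M C.b)))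

/-- The fourth differential `R ⊗ M → (R ⊗ M)²`. -/
noncomputable def d₄ : (R ⊗[k] M) →ₗ[R] ((R ⊗[k] M) × (R ⊗[k] M)) :=
  (act k M C.d).prod (rmul k M C.a)

variable {M}

lemma d₁_apply (p q s : R ⊗[k] M) : C.d₁ M (p, q, s) =
    rmul k M C.b p - act k M C.b p + (rmul k M C.c q - act k M C.c q +
      (rmul k M C.d s - act k M C.d s)) := rfl

lemma act_smul_left (x : k) (v : R) (t : R ⊗[k] M) :
    act k M (x • v) t = x • act k M v t := by
  simpa [rmul_zero, act_zero] using act_comb v 0 0 x 0 0 t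

lemma d₂_apply (p q s : R ⊗[k] M) : C.d₂ M (p, q, s) =
    (rmul k M C.a p + C.β • act k M C.b p + act k M C.c q,
      C.γ • act k M C.b p + rmul k M C.b q + act k M C.d s,
      C.δ • act k M C.b p + rmul k M C.c s) := by
  simp only [← act_smul_left]
  simp [d₂]
  abel

lemma d₃_apply (p q : R ⊗[k] M) : C.d₃ M (p, q) =
    (-act k M C.c p, rmul k M C.a p - act k M C.d q, rmul k M C.b q) := by
  simp [d₃, sub_eq_add_neg]

lemma d₄_apply (p : R ⊗[k] M) : C.d₄ M p = (act k M C.d p, rmul k M C.a p) := rfl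

lemma aug_d₁ (x) : aug k M (C.d₁ M x) = 0 := by
  obtain ⟨p, q, s⟩ := x
  simp [d₁_apply, aug_rmul]

lemma d₁_d₂ (x) : C.d₁ M (C.d₂ M x) = 0 := by
  obtain ⟨p, q, s⟩ := x
  have h1 := rmul_comb C.b C.c C.d C.β C.γ C.δ (act k M C.b p)
  have h2 := act_comb C.b C.c C.d C.β C.γ C.δ (act k M C.b p)
  rw [← C.a_eq] at h1 h2
  rw [act_act, C.ab, act_zero] at h2
  simp only [d₂_apply, d₁_apply, map_add, act_rmul, rmul_rmul, act_act, C.ab, C.bc, C.cd,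
    rmul_zero, act_zero, rmul_smul, act_smul] at h1 h2 ⊢
  rw [h1]
  linear_combination (norm := module) h2

lemma d₂_d₃ (x) : C.d₂ M (C.d₃ M x) = 0 := by
  obtain ⟨p, q⟩ := x
  simp [d₂_apply, d₃_apply, act_rmul, rmul_rmul, act_act, C.ab, C.bc, C.cd,
    rmul_zero, act_zero]

lemma d₃_d₄ (x) : C.d₃ M (C.d₄ M x) = 0 := by
  simp [d₃_apply, d₄_apply, act_rmul, rmul_rmul, act_act, C.ab, C.cd,
    rmul_zero, act_zero]

end Complex
end AnnihilatorChain

/-! ### Exactness of the complex. -/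

namespace AnnihilatorChain

variable {k R : Type*} [Field k] [Ring R] [Algebra k R] (C : AnnihilatorChain k R)

section Exactness

variable {M : Type*} [AddCommGroup M] [Module k M] [Module R M] [IsScalarTower k R M]

lemma filt_zero : C.filt M 0 = ⊥ := by
  simp [filt]

lemma filt_mono {m n : ℕ} (h : m ≤ n) : C.filt M m ≤ C.filt M n := by
  refine Submodule.span_mono ?_
  rintro t ⟨i, hi, r, hr, m, rfl⟩
  exact ⟨i, hi.trans_le h, r, hr, m, rfl⟩

lemma exists_mem_filt (t : R ⊗[k] M) : ∃ n, t ∈ C.filt M n := by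
  induction t with
  | zero => exact ⟨0, zero_mem _⟩
  | add s t hs ht =>
    obtain ⟨m, hm⟩ := hs
    obtain ⟨n, hn⟩ := ht
    exact ⟨max m n, add_mem (C.filt_mono (le_max_left m n) hm) (C.filt_mono (le_max_right m n) hn)⟩
  | tmul r m =>
    have hr : r ∈ ⨆ n : ℕ, C.W ^ n := C.iSup_pow ▸ Submodule.mem_top
    induction hr using Submodule.iSup_induction' with
    | mem i r hr => exact ⟨i + 1, Submodule.subset_span ⟨i, i.lt_succ_self, r, hr, m, rfl⟩⟩
    | zero => exact ⟨0, by simp⟩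
    | add r s _ _ hr hs =>
      obtain ⟨p, hp⟩ := hr
      obtain ⟨q, hq⟩ := hs
      rw [TensorProduct.add_tmul]
      exact ⟨max p q,
        add_mem (C.filt_mono (le_max_left p q) hp) (C.filt_mono (le_max_right p q) hq)⟩

lemma act_mem_filt {n : ℕ} (v : R) {t : R ⊗[k] M} (ht : t ∈ C.filt M n) :
    act k M v t ∈ C.filt M n := by
  induction ht using Submodule.span_induction with
  | mem t h =>
    obtain ⟨i, hi, r, hr, m, rfl⟩ := h
    exact Submodule.subset_span ⟨i, hi, r, hr, v • m, rfl⟩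
  | zero => simp
  | add s t _ _ hs ht => rw [map_add]; exact add_mem hs ht
  | smul x t _ ht => rw [act_smul]; exact Submodule.smul_mem _ _ ht

lemma rTensor_mem_filt {D : R →ₗ[k] R} (h1 : D 1 = 0)
    (hD : ∀ n : ℕ, ∀ r ∈ C.W ^ (n + 1), D r ∈ C.W ^ n) {n : ℕ} {t : R ⊗[k] M}
    (ht : t ∈ C.filt M (n + 1)) : D.rTensor M t ∈ C.filt M n := by
  induction ht using Submodule.span_induction with
  | mem t h =>
    obtain ⟨i, hi, r, hr, m, rfl⟩ := h
    rw [LinearMap.rTensor_tmul]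
    cases i with
    | zero =>
      rw [pow_zero, Submodule.mem_one] at hr
      obtain ⟨x, rfl⟩ := hr
      simp [Algebra.algebraMap_eq_smul_one, h1]
    | succ i => exact Submodule.subset_span ⟨i, by omega, D r, hD i r hr, m, rfl⟩
  | zero => simp
  | add s t _ _ hs ht => rw [map_add]; exact add_mem hs ht
  | smul x t _ ht => rw [map_smul]; exact Submodule.smul_mem _ _ ht

lemma rTensor_rmul_cancel {D : R →ₗ[k] R} {v : R} (h : ∀ r, D (r * v) = r) (t : R ⊗[k] M) :
    D.rTensor M (rmul k M v t) = t := by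
  induction t with
  | zero => simp
  | add s t hs ht => rw [map_add, map_add, hs, ht]
  | tmul r m => simp [h]

lemma rTensor_rmul_eq_zero {D : R →ₗ[k] R} {v : R} (h : ∀ r, D (r * v) = 0) (t : R ⊗[k] M) :
    D.rTensor M (rmul k M v t) = 0 := by
  induction t with
  | zero => simp
  | add s t hs ht => rw [map_add, map_add, hs, ht, add_zero]
  | tmul r m => simp [h]

lemma sub_rTensor_rmul {D E : R →ₗ[k] R} {u v : R}
    (h : ∀ r, r - D (r * v) = E (r - D (r * v)) * u) (t : R ⊗[k] M) :
    t - D.rTensor M (rmul k M v t) =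
      rmul k M u (E.rTensor M (t - D.rTensor M (rmul k M v t))) := by
  induction t with
  | zero => simp
  | add s t hs ht =>
    have : s + t - D.rTensor M (rmul k M v (s + t)) =
        (s - D.rTensor M (rmul k M v s)) + (t - D.rTensor M (rmul k M v t)) := by
      simp only [map_add]; abel
    rw [this, map_add, map_add, ← hs, ← ht]
  | tmul r m =>
    simp only [rmul_tmul, LinearMap.rTensor_tmul, ← TensorProduct.sub_tmul]
    rw [← h]

lemma d₄_injective : Function.Injective (C.d₄ M) := by
  rw [injective_iff_map_eq_zero]
  intro t ht
  rw [d₄_apply, Prod.mk_eq_zero] at ht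
  rw [← rTensor_rmul_cancel C.Da_a t, ht.2, map_zero]

lemma exists_d₄_eq (x) (hx : C.d₃ M x = 0) : ∃ y, C.d₄ M y = x := by
  obtain ⟨p, q⟩ := x
  simp only [d₃_apply, Prod.mk_eq_zero, neg_eq_zero, sub_eq_zero] at hx
  obtain ⟨-, h2, h3⟩ := hx
  have hq := sub_rTensor_rmul C.Db_b q
  rw [h3, map_zero, sub_zero] at hq
  refine ⟨C.Da.rTensor M q, ?_⟩
  rw [d₄_apply, ← hq, act_rTensor, ← h2, rTensor_rmul_cancel C.Da_a]

/-- Right multiplications raise the degree of the left factor by one, while actions on `M` preserve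
it. The top-degree part of a cycle is therefore a cycle for the right multiplications alone, where
exactness is the annihilator condition; subtracting the corresponding boundary lowers the
filtration. -/
lemma exists_d₃_eq_of_mem_filt (n : ℕ) : ∀ p ∈ C.filt M n, ∀ q ∈ C.filt M n, ∀ s ∈ C.filt M n,
    C.d₂ M (p, q, s) = 0 → ∃ y, C.d₃ M y = (p, q, s) := by
  induction n with
  | zero =>
    intro p hp q hq s hs _
    rw [filt_zero, Submodule.mem_bot] at hp hq hs
    subst hp hq hs
    exact ⟨0, map_zero _⟩
  | succ n ih =>
    intro p hp q hq s hs h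
    have h' := h
    simp only [d₂_apply, Prod.mk_eq_zero] at h
    obtain ⟨h1, h2, h3⟩ := h
    set P := C.Da.rTensor M (q - C.Db.rTensor M (rmul k M C.b q)) with hP
    set Q := C.Db.rTensor M (s - C.Dc.rTensor M (rmul k M C.c s)) with hQ
    have eP : q - C.Db.rTensor M (rmul k M C.b q) = rmul k M C.a P := sub_rTensor_rmul C.Db_b q
    have eQ : s - C.Dc.rTensor M (rmul k M C.c s) = rmul k M C.b Q := sub_rTensor_rmul C.Dc_c s
    have ma {t} (ht : t ∈ C.filt M (n + 1)) := C.rTensor_mem_filt C.Da_one C.Da_pow ht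
    have mb {t} (ht : t ∈ C.filt M (n + 1)) := C.rTensor_mem_filt C.Db_one C.Db_pow ht
    have mc {t} (ht : t ∈ C.filt M (n + 1)) := C.rTensor_mem_filt C.Dc_one C.Dc_pow ht
    have inc {t} (ht : t ∈ C.filt M n) := C.filt_mono n.le_succ ht
    have sm (x : k) {m : ℕ} {t} (ht : t ∈ C.filt M m) := (C.filt M m).smul_mem x ht
    have e1 : rmul k M C.a p = -(C.β • act k M C.b p + act k M C.c q) := by
      rw [← add_zero (-_), ← h1]; abel
    have e2 : rmul k M C.b q = -(C.γ • act k M C.b p + act k M C.d s) := by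
      rw [← add_zero (-_), ← h2]; abel
    have e3 : rmul k M C.c s = -(C.δ • act k M C.b p) := by
      rw [← add_zero (-_), ← h3]; abel
    -- The cycle equation puts `p * a` in the same filtration step as `p, q`, and division by `a`
    -- loses one degree.
    have m1 : p ∈ C.filt M n := by
      rw [← rTensor_rmul_cancel C.Da_a p, e1]
      exact ma (neg_mem (add_mem (sm _ (C.act_mem_filt _ hp)) (C.act_mem_filt _ hq)))
    have m2 : C.Db.rTensor M (rmul k M C.b q) ∈ C.filt M n := by
      rw [e2]
      exact mb (neg_mem (add_mem (sm _ (C.act_mem_filt _ hp)) (C.act_mem_filt _ hs)))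
    have m3 : C.Dc.rTensor M (rmul k M C.c s) ∈ C.filt M n := by
      rw [e3]
      exact mc (neg_mem (sm _ (C.act_mem_filt _ hp)))
    have mP : P ∈ C.filt M n := ma (sub_mem hq (inc m2))
    have mQ : Q ∈ C.filt M n := mb (sub_mem hs (inc m3))
    have key : (p, q, s) = C.d₃ M (P, Q) + (p + act k M C.c P,
        C.Db.rTensor M (rmul k M C.b q) + act k M C.d Q, C.Dc.rTensor M (rmul k M C.c s)) := by
      rw [d₃_apply, ← eP, ← eQ]
      ext <;> simp
    obtain ⟨y, hy⟩ := ih _ (add_mem m1 (C.act_mem_filt C.c mP)) _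
      (add_mem m2 (C.act_mem_filt C.d mQ)) _ m3 (by
        rw [key, map_add, d₂_d₃, zero_add] at h'
        exact h')
    exact ⟨(P, Q) + y, by rw [map_add, hy, ← key]⟩

lemma exists_d₃_eq (x) (hx : C.d₂ M x = 0) : ∃ y, C.d₃ M y = x := by
  obtain ⟨p, q, s⟩ := x
  obtain ⟨i, hi⟩ := C.exists_mem_filt p
  obtain ⟨j, hj⟩ := C.exists_mem_filt q
  obtain ⟨l, hl⟩ := C.exists_mem_filt s
  exact C.exists_d₃_eq_of_mem_filt (i + j + l) _ (C.filt_mono (by omega) hi) _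
    (C.filt_mono (by omega) hj) _ (C.filt_mono (by omega) hl) hx

lemma exists_d₂_eq_of_mem_filt (n : ℕ) : ∀ p ∈ C.filt M n, ∀ q ∈ C.filt M n, ∀ s ∈ C.filt M n,
    C.d₁ M (p, q, s) = 0 → ∃ y, C.d₂ M y = (p, q, s) := by
  induction n with
  | zero =>
    intro p hp q hq s hs _
    rw [filt_zero, Submodule.mem_bot] at hp hq hs
    subst hp hq hs
    exact ⟨0, map_zero _⟩
  | succ n ih =>
    intro p hp q hq s hs h
    have h' := h
    rw [d₁_apply] at h
    set P := C.Da.rTensor M (p - C.Db.rTensor M (rmul k M C.b p)) with hP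
    set Q := C.Db.rTensor M (q - C.Dc.rTensor M (rmul k M C.c q)) with hQ
    set S := C.Dc.rTensor M (s - C.Dd.rTensor M (rmul k M C.d s)) with hS
    have eP : p - C.Db.rTensor M (rmul k M C.b p) = rmul k M C.a P := sub_rTensor_rmul C.Db_b p
    have eQ : q - C.Dc.rTensor M (rmul k M C.c q) = rmul k M C.b Q := sub_rTensor_rmul C.Dc_c q
    have eS : s - C.Dd.rTensor M (rmul k M C.d s) = rmul k M C.c S := sub_rTensor_rmul C.Dd_d s
    have ma {t} (ht : t ∈ C.filt M (n + 1)) := C.rTensor_mem_filt C.Da_one C.Da_pow ht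
    have mb {t} (ht : t ∈ C.filt M (n + 1)) := C.rTensor_mem_filt C.Db_one C.Db_pow ht
    have mc {t} (ht : t ∈ C.filt M (n + 1)) := C.rTensor_mem_filt C.Dc_one C.Dc_pow ht
    have md {t} (ht : t ∈ C.filt M (n + 1)) := C.rTensor_mem_filt C.Dd_one C.Dd_pow ht
    have inc {t} (ht : t ∈ C.filt M n) := C.filt_mono n.le_succ ht
    have sm (x : k) {m : ℕ} {t} (ht : t ∈ C.filt M m) := (C.filt M m).smul_mem x ht
    set L := act k M C.b p + act k M C.c q + act k M C.d s with hL
    have e : rmul k M C.b p + rmul k M C.c q + rmul k M C.d s = L := by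
      rw [hL, ← sub_eq_zero, ← h]; abel
    have mL : L ∈ C.filt M (n + 1) :=
      add_mem (add_mem (C.act_mem_filt _ hp) (C.act_mem_filt _ hq)) (C.act_mem_filt _ hs)
    -- `Db` kills right multiples of `c` and `d`, so it isolates the `b` summand; this is where
    -- directness of `Rb ⊕ Rc ⊕ Rd` enters.
    have m1 : C.Db.rTensor M (rmul k M C.b p) ∈ C.filt M n := by
      have := mb mL
      rwa [← e, map_add, map_add, rTensor_rmul_eq_zero C.Db_c, rTensor_rmul_eq_zero C.Db_d,
        add_zero, add_zero] at this
    have m2 : C.Dc.rTensor M (rmul k M C.c q) ∈ C.filt M n := by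
      have := mc mL
      rwa [← e, map_add, map_add, rTensor_rmul_eq_zero C.Dc_b, rTensor_rmul_eq_zero C.Dc_d,
        add_zero, zero_add] at this
    have m3 : C.Dd.rTensor M (rmul k M C.d s) ∈ C.filt M n := by
      have := md mL
      rwa [← e, map_add, map_add, rTensor_rmul_eq_zero C.Dd_b, rTensor_rmul_eq_zero C.Dd_c,
        add_zero, zero_add] at this
    have mP : P ∈ C.filt M n := ma (sub_mem hp (inc m1))
    have mQ : Q ∈ C.filt M n := mb (sub_mem hq (inc m2))
    have mS : S ∈ C.filt M n := mc (sub_mem hs (inc m3))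
    have key : (p, q, s) = C.d₂ M (P, Q, S) +
        (C.Db.rTensor M (rmul k M C.b p) - C.β • act k M C.b P - act k M C.c Q,
          C.Dc.rTensor M (rmul k M C.c q) - C.γ • act k M C.b P - act k M C.d S,
          C.Dd.rTensor M (rmul k M C.d s) - C.δ • act k M C.b P) := by
      rw [d₂_apply, ← eP, ← eQ, ← eS]
      simp only [Prod.mk_add_mk, Prod.mk.injEq]
      refine ⟨?_, ?_, ?_⟩ <;> abel
    obtain ⟨y, hy⟩ := ih _
      (sub_mem (sub_mem m1 (sm _ (C.act_mem_filt _ mP))) (C.act_mem_filt _ mQ)) _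
      (sub_mem (sub_mem m2 (sm _ (C.act_mem_filt _ mP))) (C.act_mem_filt _ mS)) _
      (sub_mem m3 (sm _ (C.act_mem_filt _ mP))) (by
        rw [key, map_add, d₁_d₂, zero_add] at h'
        exact h')
    exact ⟨(P, Q, S) + y, by rw [map_add, hy, ← key]⟩

lemma exists_d₂_eq (x) (hx : C.d₁ M x = 0) : ∃ y, C.d₂ M y = x := by
  obtain ⟨p, q, s⟩ := x
  obtain ⟨i, hi⟩ := C.exists_mem_filt p
  obtain ⟨j, hj⟩ := C.exists_mem_filt q
  obtain ⟨l, hl⟩ := C.exists_mem_filt s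
  exact C.exists_d₂_eq_of_mem_filt (i + j + l) _ (C.filt_mono (by omega) hi) _
    (C.filt_mono (by omega) hj) _ (C.filt_mono (by omega) hl) hx

lemma decomp_tensor (t : R ⊗[k] M) : ∃ m : M, t = 1 ⊗ₜ m +
    rmul k M C.b (C.Db.rTensor M t) + rmul k M C.c (C.Dc.rTensor M t) +
    rmul k M C.d (C.Dd.rTensor M t) := by
  induction t with
  | zero => exact ⟨0, by simp⟩
  | add s t hs ht =>
    obtain ⟨m, hm⟩ := hs
    obtain ⟨m', hm'⟩ := ht
    refine ⟨m + m', ?_⟩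
    nth_rw 1 [hm, hm']
    simp only [map_add, TensorProduct.tmul_add]
    abel
  | tmul r m =>
    refine ⟨C.ε r • m, ?_⟩
    simp only [LinearMap.rTensor_tmul, rmul_tmul]
    nth_rw 1 [C.decomp r]
    simp [TensorProduct.add_tmul, Algebra.algebraMap_eq_smul_one, TensorProduct.smul_tmul]

/-- Modulo the image of `d₁`, a right factor `b`, `c` or `d` of the left tensor factor can be moved
to act on `M`, which lowers the degree until only `1` is left. -/
lemma exists_eq_d₁_add (n : ℕ) : ∀ t ∈ C.filt M n, ∃ x, ∃ m : M, t = C.d₁ M x + 1 ⊗ₜ m := by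
  induction n with
  | zero =>
    intro t ht
    rw [filt_zero, Submodule.mem_bot] at ht
    exact ⟨0, 0, by simp [ht]⟩
  | succ n ih =>
    intro t ht
    obtain ⟨m, hm⟩ := C.decomp_tensor t
    obtain ⟨x, m', hx⟩ := ih _ (add_mem (add_mem
      (C.act_mem_filt C.b (C.rTensor_mem_filt C.Db_one C.Db_pow ht))
      (C.act_mem_filt C.c (C.rTensor_mem_filt C.Dc_one C.Dc_pow ht)))
      (C.act_mem_filt C.d (C.rTensor_mem_filt C.Dd_one C.Dd_pow ht)))
    refine ⟨(C.Db.rTensor M t, C.Dc.rTensor M t, C.Dd.rTensor M t) + x, m + m', ?_⟩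
    nth_rw 1 [hm]
    rw [map_add, TensorProduct.tmul_add, d₁_apply, eq_sub_of_add_eq hx.symm]
    abel

lemma exists_d₁_eq (t : R ⊗[k] M) (ht : aug k M t = 0) : ∃ x, C.d₁ M x = t := by
  obtain ⟨n, hn⟩ := C.exists_mem_filt t
  obtain ⟨x, m, rfl⟩ := C.exists_eq_d₁_add n t hn
  rw [map_add, aug_d₁, zero_add, aug_tmul, one_smul] at ht
  exact ⟨x, by simp [ht]⟩

lemma aug_surjective : Function.Surjective (aug k M : R ⊗[k] M →ₗ[R] M) :=
  fun m => ⟨1 ⊗ₜ m, by simp⟩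

end Exactness
end AnnihilatorChain

/-! ### Projective and global dimension. -/

section ProjectiveDimension

open CategoryTheory

variable {R : Type u} [Ring R]

/-- Dimension shifting along `0 → ker f → P → range f → 0`. -/
lemma hasProjectiveDimensionLT_range_iff {P Q : Type u} [AddCommGroup P] [Module R P]
    [AddCommGroup Q] [Module R Q] [Module.Projective R P] (f : P →ₗ[R] Q) (n : ℕ) :
    HasProjectiveDimensionLT (ModuleCat.of R (LinearMap.range f)) (n + 2) ↔
      HasProjectiveDimensionLT (ModuleCat.of R (LinearMap.ker f)) (n + 1) := by
  have h := LinearMap.shortExact_shortComplexKer f.surjective_rangeRestrict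
  have h' := h.hasProjectiveDimensionLT_X₃_iff n ((IsProjective.iff_projective P).1 inferInstance)
  rw [← f.ker_rangeRestrict]
  exact h'

lemma hasProjectiveDimensionLT_one_iff (P : Type u) [AddCommGroup P] [Module R P] :
    HasProjectiveDimensionLT (ModuleCat.of R P) 1 ↔ Module.Projective R P := by
  rw [← projective_iff_hasProjectiveDimensionLT_one, IsProjective.iff_projective]

lemma hasProjectiveDimensionLT_congr {M N : Type u} [AddCommGroup M] [Module R M]
    [AddCommGroup N] [Module R N] (e : M ≃ₗ[R] N) (n : ℕ) :
    HasProjectiveDimensionLT (ModuleCat.of R M) n ↔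
      HasProjectiveDimensionLT (ModuleCat.of R N) n :=
  ⟨fun _ => hasProjectiveDimensionLT_of_iso e.toModuleIso n,
    fun _ => hasProjectiveDimensionLT_of_iso e.symm.toModuleIso n⟩

end ProjectiveDimension

namespace AnnihilatorChain

open CategoryTheory

variable {k R : Type u} [Field k] [Ring R] [Algebra k R] (C : AnnihilatorChain k R)

section

variable (M : Type u) [AddCommGroup M] [Module k M] [Module R M] [IsScalarTower k R M]

/-- Three dimension shifts along the exact complex, whose terms are projective because `M` is free
over the field `k`. -/
lemma hasProjectiveDimensionLT_iff_range_d₃ (n : ℕ) :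
    HasProjectiveDimensionLT (ModuleCat.of R M) (n + 4) ↔
      HasProjectiveDimensionLT (ModuleCat.of R (LinearMap.range (C.d₃ M))) (n + 1) := by
  have h0 : LinearMap.range (aug k M : R ⊗[k] M →ₗ[R] M) = ⊤ :=
    LinearMap.range_eq_top.2 (aug_surjective (R := R))
  have h1 : LinearMap.ker (aug k M : R ⊗[k] M →ₗ[R] M) = LinearMap.range (C.d₁ M) :=
    le_antisymm (fun t ht => C.exists_d₁_eq t ht) (by rintro _ ⟨x, rfl⟩; exact C.aug_d₁ x)
  have h2 : LinearMap.ker (C.d₁ M) = LinearMap.range (C.d₂ M) :=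
    le_antisymm (fun t ht => C.exists_d₂_eq t ht) (by rintro _ ⟨x, rfl⟩; exact C.d₁_d₂ x)
  have h3 : LinearMap.ker (C.d₂ M) = LinearMap.range (C.d₃ M) :=
    le_antisymm (fun t ht => C.exists_d₃_eq t ht) (by rintro _ ⟨x, rfl⟩; exact C.d₂_d₃ x)
  rw [← hasProjectiveDimensionLT_congr (LinearEquiv.ofTop _ h0) (n + 4),
    hasProjectiveDimensionLT_range_iff _ (n + 2), h1, hasProjectiveDimensionLT_range_iff _ (n + 1),
    h2, hasProjectiveDimensionLT_range_iff _ n, h3]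

lemma ker_d₃ : LinearMap.ker (C.d₃ M) = LinearMap.range (C.d₄ M) :=
  le_antisymm (fun t ht => C.exists_d₄_eq t ht) (by rintro _ ⟨x, rfl⟩; exact C.d₃_d₄ x)

lemma hasProjectiveDimensionLT_five (C : AnnihilatorChain k R) (M : Type u) [AddCommGroup M]
    [Module k M] [Module R M] [IsScalarTower k R M] :
    HasProjectiveDimensionLT (ModuleCat.of R M) 5 := by
  rw [C.hasProjectiveDimensionLT_iff_range_d₃ M 1, hasProjectiveDimensionLT_range_iff _ 0,
    C.ker_d₃, hasProjectiveDimensionLT_one_iff]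
  exact Module.Projective.of_equiv (LinearEquiv.ofInjective (C.d₄ M) C.d₄_injective)

/-- If every element of `W` acts as zero on `M ≠ 0`, then the fourth syzygy of `M` does not
split off. -/
lemma not_hasProjectiveDimensionLT_four [Nontrivial M] (hM : ∀ w ∈ C.W, ∀ m : M, w • m = 0) :
    ¬ HasProjectiveDimensionLT (ModuleCat.of R M) 4 := by
  rw [C.hasProjectiveDimensionLT_iff_range_d₃ M 0, hasProjectiveDimensionLT_one_iff]
  intro _
  obtain ⟨σ, hσ⟩ := Module.projective_lifting_property (C.d₃ M).rangeRestrict LinearMap.id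
    (C.d₃ M).surjective_rangeRestrict
  obtain ⟨m, hm⟩ := exists_ne (0 : M)
  -- As `d` kills `m`, the element `d₄ (1 ⊗ m)` is divisible by `a`. A splitting would make `1 ⊗ m`
  -- divisible by `a` too, and then the augmentation gives `m ∈ a • M = 0`.
  have hd : C.d₄ M (1 ⊗ₜ m) = C.a • ((0 : R ⊗[k] M), (1 : R) ⊗ₜ[k] m) := by
    simp [d₄_apply, hM _ C.d_mem, TensorProduct.smul_tmul']
  set y : (R ⊗[k] M) × (R ⊗[k] M) := (0, 1 ⊗ₜ m) with hy
  have hz : C.d₃ M (y - σ ((C.d₃ M).rangeRestrict y)) = 0 := by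
    have := congrArg Subtype.val (LinearMap.congr_fun hσ ((C.d₃ M).rangeRestrict y))
    simp only [LinearMap.comp_apply, LinearMap.id_apply] at this
    rw [map_sub, sub_eq_zero]
    exact this.symm
  obtain ⟨t, ht⟩ := C.exists_d₄_eq _ hz
  have h1 : C.d₄ M (C.a • t) = C.d₄ M (1 ⊗ₜ m) := by
    rw [map_smul, ht, smul_sub, ← map_smul σ, ← map_smul (C.d₃ M).rangeRestrict, ← hd,
      sub_eq_self]
    have : (C.d₃ M).rangeRestrict (C.d₄ M (1 ⊗ₜ m)) = 0 := Subtype.ext (C.d₃_d₄ _)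
    rw [this, map_zero]
  have h2 := C.d₄_injective h1
  have h3 := congrArg (aug k M) h2
  rw [map_smul, hM _ C.a_mem, aug_tmul, one_smul] at h3
  exact hm h3.symm

end

theorem leftGlobalDimension_eq {k R : Type u} [Field k] [Ring R] [Algebra k R]
    (C : AnnihilatorChain k R) : leftGlobalDimension R = 4 := by
  refine le_antisymm (iSup_le fun M => ?_) ?_
  · let _ : Module k M := Module.compHom M (algebraMap k R)
    have _ : IsScalarTower k R M := ⟨fun x r m => by
      rw [Algebra.smul_def, mul_smul]; rfl⟩
    exact (projectiveDimension_le_iff M 4).2 (C.hasProjectiveDimensionLT_five M)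
  · let _ : Module R k := Module.compHom k (C.ε : R →+* k)
    have hsmul (r : R) (x : k) : r • x = C.ε r * x := rfl
    have _ : IsScalarTower k R k := ⟨fun x r m => by simp [hsmul, mul_assoc]⟩
    refine le_trans ?_ (le_iSup _ (ModuleCat.of R k))
    refine (projectiveDimension_ge_iff (ModuleCat.of R k) 4).2
      (C.not_hasProjectiveDimensionLT_four k fun w hw m => ?_)
    rw [hsmul, C.ε_mem w hw, zero_mul]

end AnnihilatorChain

/-! ### The bar complex and operations on its last tensor factor. -/

noncomputable section BarComplex

variable {k A : Type u} [Field k] [Ring A] [Algebra k A]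

/-- The map `a₁ ⊗ … ⊗ aₙ ↦ a₁ ⊗ … ⊗ aₙ ⊗ v`. -/
def tensorSnoc (k : Type u) {A : Type u} [Field k] [Ring A] [Algebra k A] (n : ℕ) (v : A) :
    (⨂[k]^n A) →ₗ[k] (⨂[k]^(n + 1) A) :=
  PiTensorProduct.lift ((LinearMap.applyₗ v).compMultilinearMap
    (PiTensorProduct.tprod k : MultilinearMap k (fun _ : Fin (n + 1) => A) _).curryRight)

/-- The map `a₁ ⊗ … ⊗ aₙ₊₁ ↦ a₁ ⊗ … ⊗ aₙ ⊗ f aₙ₊₁`. -/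
def lastMap (n : ℕ) (f : A →ₗ[k] A) : (⨂[k]^(n + 1) A) →ₗ[k] (⨂[k]^(n + 1) A) :=
  PiTensorProduct.lift (((LinearMap.lcomp k _ f).compMultilinearMap
    (PiTensorProduct.tprod k : MultilinearMap k (fun _ : Fin (n + 1) => A) _).curryRight
      ).uncurryRight)

/-- The map `a₁ ⊗ … ⊗ aₙ₊₁ ↦ g aₙ₊₁ • (a₁ ⊗ … ⊗ aₙ)`. -/
def contractLast (n : ℕ) (g : A →ₗ[k] k) : (⨂[k]^(n + 1) A) →ₗ[k] (⨂[k]^n A) :=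
  PiTensorProduct.lift (((LinearMap.smulRightₗ g : (⨂[k]^n A) →ₗ[k] A →ₗ[k] (⨂[k]^n A)
    ).compMultilinearMap
    (PiTensorProduct.tprod k : MultilinearMap k (fun _ : Fin n => A) _)).uncurryRight)

@[simp] lemma tensorSnoc_tprod (n : ℕ) (v : A) (a : Fin n → A) :
    tensorSnoc k n v (PiTensorProduct.tprod k a) =
      PiTensorProduct.tprod k (Fin.snoc a v : Fin (n + 1) → A) := by
  simp [tensorSnoc]

@[simp] lemma lastMap_tprod_snoc (n : ℕ) (f : A →ₗ[k] A) (a : Fin n → A) (v : A) :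
    lastMap n f (PiTensorProduct.tprod k (Fin.snoc a v : Fin (n + 1) → A)) =
      PiTensorProduct.tprod k (Fin.snoc a (f v) : Fin (n + 1) → A) := by
  simp [lastMap]

@[simp] lemma contractLast_tprod_snoc (n : ℕ) (g : A →ₗ[k] k) (a : Fin n → A) (v : A) :
    contractLast n g (PiTensorProduct.tprod k (Fin.snoc a v : Fin (n + 1) → A)) =
      g v • PiTensorProduct.tprod k a := by
  simp [contractLast]

lemma tprod_snoc_add (n : ℕ) (a : Fin n → A) (u v : A) :
    PiTensorProduct.tprod k (Fin.snoc a (u + v) : Fin (n + 1) → A) =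
      PiTensorProduct.tprod k (Fin.snoc a u : Fin (n + 1) → A) +
        PiTensorProduct.tprod k (Fin.snoc a v : Fin (n + 1) → A) :=
  ((PiTensorProduct.tprod k : MultilinearMap k (fun _ : Fin (n + 1) => A) _).curryRight a
    ).map_add u v

lemma tprod_snoc_smul (n : ℕ) (a : Fin n → A) (x : k) (v : A) :
    PiTensorProduct.tprod k (Fin.snoc a (x • v) : Fin (n + 1) → A) =
      x • PiTensorProduct.tprod k (Fin.snoc a v : Fin (n + 1) → A) :=
  ((PiTensorProduct.tprod k : MultilinearMap k (fun _ : Fin (n + 1) => A) _).curryRight a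
    ).map_smul x v

lemma barDifferential_tprod (n : ℕ) (a : Fin (n + 1) → A) :
    barDifferential k A n (PiTensorProduct.tprod k a) =
      ∑ i : Fin n, (-1 : k) ^ (i : ℕ) •
        PiTensorProduct.tprod k (Fin.contractNth i.castSucc (· * ·) a) := by
  simp [barDifferential, barFaceMultilinear]

lemma tensorPower_hom_ext {n : ℕ} {N : Type*} [AddCommGroup N] [Module k N]
    {f g : (⨂[k]^(n + 1) A) →ₗ[k] N}
    (h : ∀ (a : Fin n → A) (v : A), f (PiTensorProduct.tprod k (Fin.snoc a v : Fin (n + 1) → A)) =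
      g (PiTensorProduct.tprod k (Fin.snoc a v : Fin (n + 1) → A))) : f = g := by
  refine PiTensorProduct.ext (MultilinearMap.ext fun a => ?_)
  rw [← Fin.snoc_init_self a]
  exact h _ _

lemma contractNth_snoc {n : ℕ} (i : Fin n) (a : Fin (n + 1) → A) (v : A) :
    Fin.contractNth i.castSucc.castSucc (· * ·) (Fin.snoc a v : Fin (n + 2) → A) =
      (Fin.snoc (Fin.contractNth i.castSucc (· * ·) a : Fin n → A) v : Fin (n + 1) → A) := by
  ext l
  refine Fin.lastCases ?_ (fun l => ?_) l
  · have h := i.2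
    rw [Fin.contractNth_apply_of_gt _ _ _ _ (by simp)]
    rw [Fin.succ_last, Fin.snoc_last, Fin.snoc_last]
  · rw [Fin.snoc_castSucc]
    simp only [Fin.contractNth, Fin.val_castSucc, Fin.snoc_castSucc, Fin.succ_castSucc]

lemma contractNth_last_snoc {n : ℕ} (a : Fin n → A) (u v : A) :
    Fin.contractNth (Fin.last n).castSucc (· * ·)
      (Fin.snoc (Fin.snoc a u : Fin (n + 1) → A) v : Fin (n + 2) → A) =
      (Fin.snoc a (u * v) : Fin (n + 1) → A) := by
  ext l
  refine Fin.lastCases ?_ (fun l => ?_) l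
  · rw [Fin.contractNth_apply_of_eq _ _ _ _ (by simp)]
    simp [Fin.succ_last, Fin.snoc_last]
  · rw [Fin.contractNth_apply_of_lt _ _ _ _ (by simp)]
    simp

lemma lastMap_comp (n : ℕ) (f g : A →ₗ[k] A) (t : ⨂[k]^(n + 1) A) :
    lastMap n f (lastMap n g t) = lastMap n (f ∘ₗ g) t := by
  have : lastMap n f ∘ₗ lastMap n g = lastMap n (f ∘ₗ g) :=
    tensorPower_hom_ext fun a v => by simp
  exact LinearMap.congr_fun this t

lemma lastMap_add (n : ℕ) (f g : A →ₗ[k] A) (t : ⨂[k]^(n + 1) A) :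
    lastMap n (f + g) t = lastMap n f t + lastMap n g t := by
  have : lastMap n (f + g) = lastMap n f + lastMap n g :=
    tensorPower_hom_ext fun a v => by simp [tprod_snoc_add]
  exact LinearMap.congr_fun this t

lemma lastMap_id (n : ℕ) (t : ⨂[k]^(n + 1) A) : lastMap n LinearMap.id t = t := by
  have : lastMap n (LinearMap.id : A →ₗ[k] A) = LinearMap.id :=
    tensorPower_hom_ext fun a v => by simp
  exact LinearMap.congr_fun this t

lemma lastMap_smulRight (n : ℕ) (g : A →ₗ[k] k) (v : A) (t : ⨂[k]^(n + 1) A) :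
    lastMap n (g.smulRight v) t = tensorSnoc k n v (contractLast n g t) := by
  have : lastMap n (g.smulRight v) = tensorSnoc k n v ∘ₗ contractLast n g :=
    tensorPower_hom_ext fun a w => by
      simp only [lastMap_tprod_snoc, LinearMap.smulRight_apply, LinearMap.comp_apply,
        contractLast_tprod_snoc, map_smul, tensorSnoc_tprod, tprod_snoc_smul]
  exact LinearMap.congr_fun this t

lemma lastMap_tensorSnoc (n : ℕ) (f : A →ₗ[k] A) (v : A) (t : ⨂[k]^n A) :
    lastMap n f (tensorSnoc k n v t) = tensorSnoc k n (f v) t := by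
  have : lastMap n f ∘ₗ tensorSnoc k n v = tensorSnoc k n (f v) :=
    PiTensorProduct.ext (MultilinearMap.ext fun a => by simp)
  exact LinearMap.congr_fun this t

lemma contractLast_tensorSnoc (n : ℕ) (g : A →ₗ[k] k) (v : A) (t : ⨂[k]^n A) :
    contractLast n g (tensorSnoc k n v t) = g v • t := by
  have : contractLast n g ∘ₗ tensorSnoc k n v = g v • LinearMap.id :=
    PiTensorProduct.ext (MultilinearMap.ext fun a => by simp)
  exact LinearMap.congr_fun this t

lemma contractLast_lastMap (n : ℕ) (g : A →ₗ[k] k) (f : A →ₗ[k] A) (t : ⨂[k]^(n + 1) A) :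
    contractLast n g (lastMap n f t) = contractLast n (g ∘ₗ f) t := by
  have : contractLast n g ∘ₗ lastMap n f = contractLast n (g ∘ₗ f) :=
    tensorPower_hom_ext fun a v => by simp
  exact LinearMap.congr_fun this t

lemma tensorSnoc_zero (n : ℕ) (t : ⨂[k]^n A) : tensorSnoc k n (0 : A) t = 0 := by
  have : tensorSnoc k n (0 : A) = 0 := by
    refine PiTensorProduct.ext (MultilinearMap.ext fun a => ?_)
    simpa using MultilinearMap.map_coord_zero _ (Fin.last n) (by simp)
  exact LinearMap.congr_fun this t

/-- Up to sign, appending `v` is a homotopy from right multiplication by `v` to zero. All fillings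
of cycles come from this formula. -/
lemma barDifferential_tensorSnoc (n : ℕ) (v : A) (t : ⨂[k]^(n + 1) A) :
    barDifferential k A (n + 1) (tensorSnoc k (n + 1) v t) =
      tensorSnoc k n v (barDifferential k A n t) +
        (-1 : k) ^ n • lastMap n (LinearMap.mulRight k v) t := by
  have : barDifferential k A (n + 1) ∘ₗ tensorSnoc k (n + 1) v =
      tensorSnoc k n v ∘ₗ barDifferential k A n +
        (-1 : k) ^ n • lastMap n (LinearMap.mulRight k v) :=
    tensorPower_hom_ext fun a u => by
      simp only [LinearMap.comp_apply, LinearMap.add_apply, LinearMap.smul_apply,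
        tensorSnoc_tprod, barDifferential_tprod, map_sum, map_smul, lastMap_tprod_snoc,
        Fin.sum_univ_castSucc (n := n), contractNth_snoc, contractNth_last_snoc,
        Fin.val_castSucc, Fin.val_last, LinearMap.mulRight_apply]
  exact LinearMap.congr_fun this t

lemma barDifferential_lastMap (n : ℕ) (v : A) (t : ⨂[k]^(n + 2) A) :
    barDifferential k A (n + 1) (lastMap (n + 1) (LinearMap.mulRight k v) t) =
      lastMap n (LinearMap.mulRight k v) (barDifferential k A (n + 1) t) := by
  have : barDifferential k A (n + 1) ∘ₗ lastMap (n + 1) (LinearMap.mulRight k v) =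
      lastMap n (LinearMap.mulRight k v) ∘ₗ barDifferential k A (n + 1) :=
    tensorPower_hom_ext fun a u => by
      rw [← Fin.snoc_init_self a]
      simp only [LinearMap.comp_apply, lastMap_tprod_snoc, barDifferential_tprod, map_add, map_sum,
        map_smul, Fin.sum_univ_castSucc (n := n), contractNth_snoc, contractNth_last_snoc,
        LinearMap.mulRight_apply, mul_assoc]
  exact LinearMap.congr_fun this t

lemma barDifferential_zero : barDifferential k A 0 = 0 := by
  simp [barDifferential]

lemma barDifferential_barDifferential (n : ℕ) (t : ⨂[k]^(n + 2) A) :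
    barDifferential k A n (barDifferential k A (n + 1) t) = 0 := by
  revert t
  have : barDifferential k A n ∘ₗ barDifferential k A (n + 1) = 0 := by
    induction n with
    | zero => simp [barDifferential_zero]
    | succ n ih =>
      refine tensorPower_hom_ext fun a u => ?_
      rw [← tensorSnoc_tprod, LinearMap.comp_apply, barDifferential_tensorSnoc, map_add, map_smul,
        barDifferential_tensorSnoc, barDifferential_lastMap]
      have h := LinearMap.congr_fun ih (PiTensorProduct.tprod k a)
      rw [LinearMap.comp_apply, LinearMap.zero_apply] at h
      rw [h, map_zero, zero_add, ← add_smul, pow_succ]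
      simp
  exact LinearMap.congr_fun this

section Chains

variable {𝒜 : ℕ → Submodule k A}

lemma barChains_induction {n j : ℕ} {N : Type*} [AddCommGroup N] [Module k N]
    (f : (⨂[k]^(n + 1) A) →ₗ[k] N) (S : Submodule k N)
    (h : ∀ (p : Fin n → ℕ) (q : ℕ) (a : Fin n → A) (v : A), (∀ i, 1 ≤ p i) → 1 ≤ q →
      ∑ i, p i + q = j → (∀ i, a i ∈ 𝒜 (p i)) → v ∈ 𝒜 q →
      f (PiTensorProduct.tprod k (Fin.snoc a v : Fin (n + 1) → A)) ∈ S)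
    {t : ⨂[k]^(n + 1) A} (ht : t ∈ barChains 𝒜 (n + 1) j) : f t ∈ S := by
  induction ht using Submodule.span_induction with
  | mem t ht =>
    obtain ⟨p, a, hp, hj, ha, rfl⟩ := ht
    rw [Fin.sum_univ_castSucc] at hj
    rw [← Fin.snoc_init_self a]
    exact h (fun i => p i.castSucc) _ _ _ (fun i => hp _) (hp (Fin.last n)) hj (fun i => ha _)
      (ha _)
  | zero => simp
  | add s t _ _ hs ht => rw [map_add]; exact add_mem hs ht
  | smul x t _ ht => rw [map_smul]; exact S.smul_mem x ht

lemma tprod_snoc_mem_barChains {n j : ℕ} {p : Fin n → ℕ} {q : ℕ} {a : Fin n → A} {v : A}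
    (hp : ∀ i, 1 ≤ p i) (hq : 1 ≤ q) (hj : ∑ i, p i + q = j) (ha : ∀ i, a i ∈ 𝒜 (p i))
    (hv : v ∈ 𝒜 q) :
    PiTensorProduct.tprod k (Fin.snoc a v : Fin (n + 1) → A) ∈ barChains 𝒜 (n + 1) j := by
  refine Submodule.subset_span ⟨(Fin.snoc p q : Fin (n + 1) → ℕ), _, ?_, ?_, ?_, rfl⟩
  · exact Fin.lastCases (by simpa) (fun i => by simpa using hp i)
  · simpa [Fin.sum_univ_castSucc] using hj
  · exact Fin.lastCases (by simpa) (fun i => by simpa using ha i)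

lemma tensorSnoc_mem_barChains {n j : ℕ} {v : A} (hv : v ∈ 𝒜 1) {t : ⨂[k]^n A}
    (ht : t ∈ barChains 𝒜 n j) : tensorSnoc k n v t ∈ barChains 𝒜 (n + 1) (j + 1) := by
  induction ht using Submodule.span_induction with
  | mem t ht =>
    obtain ⟨p, a, hp, hj, ha, rfl⟩ := ht
    rw [tensorSnoc_tprod]
    exact tprod_snoc_mem_barChains hp le_rfl (by rw [hj]) ha hv
  | zero => simp
  | add s t _ _ hs ht => rw [map_add]; exact add_mem hs ht
  | smul x t _ ht => rw [map_smul]; exact Submodule.smul_mem _ x ht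

lemma lastMap_mem_barChains {n j : ℕ} {f : A →ₗ[k] A} (h1 : ∀ r ∈ 𝒜 1, f r = 0)
    (h2 : ∀ m, ∀ r ∈ 𝒜 (m + 2), f r ∈ 𝒜 (m + 1)) {t : ⨂[k]^(n + 1) A}
    (ht : t ∈ barChains 𝒜 (n + 1) (j + 1)) : lastMap n f t ∈ barChains 𝒜 (n + 1) j := by
  refine barChains_induction _ _ (fun p q a v hp hq hj ha hv => ?_) ht
  rw [lastMap_tprod_snoc]
  obtain _ | _ | m := q
  · omega
  · rw [h1 v hv, ← tensorSnoc_tprod, tensorSnoc_zero]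
    exact zero_mem _
  · exact tprod_snoc_mem_barChains hp (by omega) (by omega) ha (h2 m v hv)

lemma contractLast_mem_barChains {n j : ℕ} {g : A →ₗ[k] k} (h : ∀ m, ∀ r ∈ 𝒜 (m + 2), g r = 0)
    {t : ⨂[k]^(n + 1) A} (ht : t ∈ barChains 𝒜 (n + 1) (j + 1)) :
    contractLast n g t ∈ barChains 𝒜 n j := by
  refine barChains_induction _ _ (fun p q a v hp hq hj ha hv => ?_) ht
  rw [contractLast_tprod_snoc]
  obtain _ | _ | m := q
  · omega
  · exact Submodule.smul_mem _ _ (Submodule.subset_span ⟨p, a, hp, by omega, ha, rfl⟩)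
  · rw [h m v hv, zero_smul]
    exact zero_mem _

lemma contractLast_eq_zero {n j : ℕ} {g : A →ₗ[k] k} (h : ∀ m, ∀ r ∈ 𝒜 (m + 1), g r = 0)
    {t : ⨂[k]^(n + 1) A} (ht : t ∈ barChains 𝒜 (n + 1) j) : contractLast n g t = 0 := by
  rw [← Submodule.mem_bot k]
  refine barChains_induction _ _ (fun p q a v hp hq hj ha hv => ?_) ht
  obtain _ | m := q
  · omega
  · rw [contractLast_tprod_snoc, h m v hv, zero_smul]
    exact zero_mem _

/-- Contraction omits one partial sum, and never the last one. -/
lemma sum_contractNth {n : ℕ} (i : Fin n) (p : Fin (n + 1) → ℕ) :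
    ∑ l, Fin.contractNth i.castSucc (· + ·) p l = ∑ l, p l := by
  have h := congrFun (Fin.partialSum_contractNth p i.castSucc) (Fin.last n)
  have hi : i.castSucc.succ.succAbove (Fin.last n) = Fin.last (n + 1) := by
    rw [Fin.succAbove_of_le_castSucc _ _ (by rw [Fin.le_def]; simp), Fin.succ_last]
  rw [Function.comp_apply, hi] at h
  rw [Fin.sum_univ_succ p]
  simpa [Fin.partialSum, List.take_of_length_le, List.sum_ofFn] using h

lemma barDifferential_mem_barChains [SetLike.GradedMonoid 𝒜] {n j : ℕ} {t : ⨂[k]^(n + 1) A}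
    (ht : t ∈ barChains 𝒜 (n + 1) j) : barDifferential k A n t ∈ barChains 𝒜 n j := by
  induction ht using Submodule.span_induction with
  | mem t ht =>
    obtain ⟨p, a, hp, hj, ha, rfl⟩ := ht
    rw [barDifferential_tprod]
    refine sum_mem fun i _ => Submodule.smul_mem _ _ (Submodule.subset_span
      ⟨Fin.contractNth i.castSucc (· + ·) p, _, fun l => ?_, ?_, fun l => ?_, rfl⟩)
    · rw [Fin.contractNth]
      split_ifs
      · exact hp _
      · exact (hp _).trans (Nat.le_add_right _ _)
      · exact hp _
    · rw [sum_contractNth, hj]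
    · simp only [Fin.contractNth]
      split_ifs
      · exact ha _
      · exact SetLike.mul_mem_graded (ha _) (ha _)
      · exact ha _
  | zero => simp
  | add s t _ _ hs ht => rw [map_add]; exact add_mem hs ht
  | smul x t _ ht => rw [map_smul]; exact Submodule.smul_mem _ x ht

lemma barChains_eq_bot_of_lt {n j : ℕ} (h : j < n) : barChains 𝒜 n j = ⊥ := by
  rw [barChains, Submodule.span_eq_bot]
  rintro _ ⟨p, a, hp, hj, -⟩
  have : ∑ i : Fin n, 1 ≤ ∑ i, p i := Finset.sum_le_sum fun i _ => hp i
  simp at this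
  omega

lemma barChains_zero_eq_bot {j : ℕ} (h : 0 < j) : barChains 𝒜 0 j = ⊥ := by
  rw [barChains, Submodule.span_eq_bot]
  rintro _ ⟨p, a, hp, hj, -⟩
  simp at hj
  omega

end Chains

end BarComplex

/-! ### Filling off-diagonal bar cycles. -/

section BarFilling

variable {k A : Type u} [Field k] [Ring A] [Algebra k A] {𝒜 : ℕ → Submodule k A}

lemma lastMap_mem_barChains_of_mapsTo {n j : ℕ} {f : A →ₗ[k] A}
    (h : ∀ m, ∀ r ∈ 𝒜 (m + 1), f r ∈ 𝒜 (m + 1)) {t : ⨂[k]^(n + 1) A}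
    (ht : t ∈ barChains 𝒜 (n + 1) j) : lastMap n f t ∈ barChains 𝒜 (n + 1) j := by
  refine barChains_induction _ _ (fun p q a v hp hq hj ha hv => ?_) ht
  rw [lastMap_tprod_snoc]
  obtain _ | m := q
  · omega
  · exact tprod_snoc_mem_barChains hp hq hj ha (h m v hv)

lemma lastMap_eq_zero {n : ℕ} {f : A →ₗ[k] A} (h : ∀ r, f r = 0) (t : ⨂[k]^(n + 1) A) :
    lastMap n f t = 0 := by
  have : lastMap n f = 0 := tensorPower_hom_ext fun a v => by
    rw [lastMap_tprod_snoc, h, ← tensorSnoc_tprod, tensorSnoc_zero, LinearMap.zero_apply]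
  exact LinearMap.congr_fun this t

/-- In internal degrees off the diagonal, the bar cycles killed by right multiplication by `v` in
the last factor are boundaries of bar chains with the same property. -/
def AnnihilatedCyclesBound (𝒜 : ℕ → Submodule k A) (v : A) : Prop :=
  ∀ m j : ℕ, m < j → ∀ η ∈ barChains 𝒜 (m + 1) (j + 1), barDifferential k A m η = 0 →
    lastMap m (LinearMap.mulRight k v) η = 0 → ∃ β ∈ barChains 𝒜 (m + 2) (j + 1),
      lastMap (m + 1) (LinearMap.mulRight k v) β = 0 ∧ barDifferential k A (m + 1) β = η

/-- In internal degrees off the diagonal, the bar cycles whose last factor is a left multiple of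
`v` are boundaries of bar chains whose last factor is `v`. -/
def MultipleCyclesBound (𝒜 : ℕ → Submodule k A) (v : A) (D : A →ₗ[k] A) : Prop :=
  ∀ n j : ℕ, n < j → ∀ η ∈ barChains 𝒜 (n + 1) (j + 1), barDifferential k A n η = 0 →
    lastMap n (LinearMap.mulRight k v) (lastMap n D η) = η →
      ∃ β ∈ barChains 𝒜 (n + 1) j, barDifferential k A (n + 1) (tensorSnoc k (n + 1) v β) = η

lemma annihilatedCyclesBound_of_injective {v : A} {D : A →ₗ[k] A} (h : ∀ r, D (r * v) = r) :
    AnnihilatedCyclesBound 𝒜 v := by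
  intro m j _ η _ _ h0
  refine ⟨0, zero_mem _, map_zero _, ?_⟩
  have : lastMap m D (lastMap m (LinearMap.mulRight k v) η) = η := by
    rw [lastMap_comp, show D ∘ₗ LinearMap.mulRight k v = LinearMap.id from
      LinearMap.ext h, lastMap_id]
  rw [map_zero, ← this, h0, map_zero]

/-- A cycle killed by `v` has its last factor in `A u`, so it is filled by some `β ⊗ u`; that
filling is itself killed by `v` because `u * v = 0`. -/
lemma annihilatedCyclesBound_of_multiple {u v : A} {D E : A →ₗ[k] A} (huv : u * v = 0)
    (hu : u ∈ 𝒜 1) (h : ∀ r, r - D (r * v) = E (r - D (r * v)) * u)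
    (H : MultipleCyclesBound 𝒜 u E) : AnnihilatedCyclesBound 𝒜 v := by
  intro m j hmj η hη hd h0
  have h1 : lastMap m (LinearMap.id - D ∘ₗ LinearMap.mulRight k v) η = η := by
    have := lastMap_add m (LinearMap.id - D ∘ₗ LinearMap.mulRight k v)
      (D ∘ₗ LinearMap.mulRight k v) η
    rwa [sub_add_cancel, lastMap_id, ← lastMap_comp, h0, map_zero, add_zero, eq_comm] at this
  have h2 : LinearMap.mulRight k u ∘ₗ E ∘ₗ (LinearMap.id - D ∘ₗ LinearMap.mulRight k v) =
      LinearMap.id - D ∘ₗ LinearMap.mulRight k v :=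
    LinearMap.ext fun r => (h r).symm
  have h3 := congrArg (fun f => lastMap m f η) h2
  simp only [← lastMap_comp _ _ (_ ∘ₗ _), ← lastMap_comp _ E, h1] at h3
  obtain ⟨β, hβ, hβη⟩ := H m j hmj η hη hd h3
  refine ⟨_, tensorSnoc_mem_barChains hu hβ, ?_, hβη⟩
  rw [lastMap_tensorSnoc, LinearMap.mulRight_apply, huv, tensorSnoc_zero]

/-- A cycle with last factor in `A v` differs from `ζ ⊗ v` by a boundary of the form `d (θ ⊗ v)`.
Since `ζ ⊗ v` is a cycle, both `d ζ` and `ζ * v` vanish, so `H` gives `ζ = d β` with `β * v = 0`,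
and then `d (β ⊗ v) = ζ ⊗ v`. -/
lemma multipleCyclesBound [SetLike.GradedMonoid 𝒜] (h𝒜 : 𝒜 0 = 1) {v : A} {D : A →ₗ[k] A}
    {ε : A →ₐ[k] k} (hv : v ∈ 𝒜 1) (hε : ∀ m, ∀ r ∈ 𝒜 (m + 1), ε r = 0)
    (hD : ∀ m, ∀ r ∈ 𝒜 (m + 1), D r ∈ 𝒜 m) (hDv : ε (D v) = 1)
    (H : AnnihilatedCyclesBound 𝒜 v) : MultipleCyclesBound 𝒜 v D := by
  intro n j hnj η hη hd hDη
  set g : A →ₗ[k] k := ε.toLinearMap ∘ₗ D with hg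
  -- A quotient by `v` may be a scalar, which is not a factor of the reduced bar complex. `g`
  -- extracts that scalar and `D'` keeps the part of positive degree.
  set D' : A →ₗ[k] A := D - g.smulRight 1 with hD'
  have hmul : LinearMap.mulRight k v ∘ₗ g.smulRight 1 = g.smulRight v :=
    LinearMap.ext fun r => by simp
  have hg0 : ∀ m, ∀ r ∈ 𝒜 (m + 2), g r = 0 := fun m r hr => hε m _ (hD (m + 1) r hr)
  have hD'1 : ∀ r ∈ 𝒜 1, D' r = 0 := fun r hr => by
    have := hD 0 r hr
    rw [h𝒜, Submodule.mem_one] at this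
    obtain ⟨x, hx⟩ := this
    simp [hD', hg, ← hx, Algebra.algebraMap_eq_smul_one]
  have hD'2 : ∀ m, ∀ r ∈ 𝒜 (m + 2), D' r ∈ 𝒜 (m + 1) := fun m r hr => by
    simpa [hD', hg0 m r hr] using hD (m + 1) r hr
  set θ := lastMap n D' η with hθ
  set s : k := (-1) ^ n with hs
  have hss : s * s = 1 := by rw [hs, ← mul_pow]; simp
  have hθm : θ ∈ barChains 𝒜 (n + 1) j := lastMap_mem_barChains hD'1 hD'2 hη
  set ζ := contractLast n g η - s • barDifferential k A n θ with hζ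
  have hζm : ζ ∈ barChains 𝒜 n j :=
    sub_mem (contractLast_mem_barChains hg0 hη)
      (Submodule.smul_mem _ _ (barDifferential_mem_barChains hθm))
  have key : η = barDifferential k A (n + 1) (tensorSnoc k (n + 1) v (s • θ)) +
      tensorSnoc k n v ζ := by
    have h1 : η = lastMap n (LinearMap.mulRight k v) θ +
        tensorSnoc k n v (contractLast n g η) := by
      nth_rw 1 [← hDη]
      rw [hθ, ← lastMap_smulRight, ← hmul, ← lastMap_comp, ← map_add, ← lastMap_add, hD',
        sub_add_cancel]
    rw [map_smul, map_smul, barDifferential_tensorSnoc, smul_add, smul_smul, hss, one_smul, hζ,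
      map_sub, map_smul]
    nth_rw 1 [h1]
    abel
  obtain _ | m := n
  · rw [barChains_zero_eq_bot hnj, Submodule.mem_bot] at hζm
    exact ⟨s • θ, Submodule.smul_mem _ _ hθm, by rw [key, hζm, map_zero, add_zero]⟩
  obtain _ | j := j
  · omega
  have hcyc : barDifferential k A (m + 1) (tensorSnoc k (m + 1) v ζ) = 0 := by
    rw [key, map_add, barDifferential_barDifferential, zero_add] at hd
    exact hd
  rw [barDifferential_tensorSnoc] at hcyc
  -- `g` takes `v` to `1` and vanishes from degree 2 on, so contracting with it removes `ζ * v` and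
  -- leaves `d ζ`.
  have hdζ : barDifferential k A m ζ = 0 := by
    have := congrArg (contractLast m g) hcyc
    rw [map_add, map_smul, contractLast_tensorSnoc, contractLast_lastMap,
      contractLast_eq_zero (fun i r hr => hg0 i (r * v)
        (show r * v ∈ 𝒜 (i + 1 + 1) from SetLike.mul_mem_graded hr hv)) hζm,
      smul_zero, add_zero, map_zero] at this
    simpa [hg, hDv] using this
  rw [hdζ, map_zero, zero_add, smul_eq_zero] at hcyc
  obtain ⟨β, hβ, hβv, hdβ⟩ := H m j (by omega) ζ hζm hdζ
    (hcyc.resolve_left (pow_ne_zero _ (neg_ne_zero.2 one_ne_zero)))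
  refine ⟨s • θ + β, add_mem (Submodule.smul_mem _ _ hθm) hβ, ?_⟩
  rw [map_add, map_add, barDifferential_tensorSnoc (m + 1) v β, hdβ, hβv, smul_zero, add_zero]
  exact key.symm

end BarFilling

namespace AnnihilatorChain

variable {k A : Type u} [Field k] [Ring A] [Algebra k A] (C : AnnihilatorChain k A)

lemma ε_pow (m : ℕ) (r : A) (hr : r ∈ C.W ^ (m + 1)) : C.ε r = 0 := by
  rw [pow_succ] at hr
  induction hr using Submodule.mul_induction_on' with
  | mem_mul_mem r _ w hw => rw [map_mul, C.ε_mem w hw, mul_zero]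
  | add r _ s _ hr hs => rw [map_add, hr, hs, add_zero]

lemma ε_div_eq_one {u v : A} {D E : A →ₗ[k] A} (hu : u ∈ C.W)
    (h : ∀ r, r - D (r * v) = E (r - D (r * v)) * u) : C.ε (D v) = 1 := by
  have := congrArg C.ε (h 1)
  rw [one_mul, map_sub, map_one, map_mul, C.ε_mem u hu, mul_zero, sub_eq_zero] at this
  exact this.symm

/-- The chain is climbed from `a`, whose annihilator is zero; multiples of each member are the
annihilator of the next. -/
lemma multipleCyclesBound_bcd :
    MultipleCyclesBound (fun n => C.W ^ n) C.b C.Db ∧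
      MultipleCyclesBound (fun n => C.W ^ n) C.c C.Dc ∧
        MultipleCyclesBound (fun n => C.W ^ n) C.d C.Dd := by
  have : SetLike.GradedMonoid (fun n : ℕ => C.W ^ n) := Submodule.nat_power_gradedMonoid C.W
  have h1 {w : A} (hw : w ∈ C.W) : w ∈ (fun n : ℕ => C.W ^ n) 1 := by simpa using hw
  have fill {v : A} {D : A →ₗ[k] A} (hv : v ∈ C.W)
      (hD : ∀ m : ℕ, ∀ r ∈ C.W ^ (m + 1), D r ∈ C.W ^ m) (hDv : C.ε (D v) = 1) :=
    multipleCyclesBound (𝒜 := fun n => C.W ^ n) (pow_zero _) (h1 hv) C.ε_pow hD hDv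
  have ha := fill C.a_mem C.Da_pow (by rw [← one_mul C.a, C.Da_a, map_one])
    (annihilatedCyclesBound_of_injective C.Da_a)
  have hb := fill C.b_mem C.Db_pow (C.ε_div_eq_one C.a_mem C.Db_b)
    (annihilatedCyclesBound_of_multiple C.ab (h1 C.a_mem) C.Db_b ha)
  have hc := fill C.c_mem C.Dc_pow (C.ε_div_eq_one C.b_mem C.Dc_c)
    (annihilatedCyclesBound_of_multiple C.bc (h1 C.b_mem) C.Dc_c hb)
  have hd := fill C.d_mem C.Dd_pow (C.ε_div_eq_one C.c_mem C.Dd_d)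
    (annihilatedCyclesBound_of_multiple C.cd (h1 C.c_mem) C.Dd_d hc)
  exact ⟨hb, hc, hd⟩

lemma lastMap_decomp {n j : ℕ} {η : ⨂[k]^(n + 1) A}
    (hη : η ∈ barChains (fun n => C.W ^ n) (n + 1) j) :
    η = lastMap n (LinearMap.mulRight k C.b) (lastMap n C.Db η) +
      lastMap n (LinearMap.mulRight k C.c) (lastMap n C.Dc η) +
      lastMap n (LinearMap.mulRight k C.d) (lastMap n C.Dd η) := by
  have h : (LinearMap.id : A →ₗ[k] A) = C.ε.toLinearMap.smulRight 1 +
      LinearMap.mulRight k C.b ∘ₗ C.Db + LinearMap.mulRight k C.c ∘ₗ C.Dc +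
      LinearMap.mulRight k C.d ∘ₗ C.Dd :=
    LinearMap.ext fun r => by simpa [Algebra.algebraMap_eq_smul_one] using C.decomp r
  have h0 : contractLast n C.ε.toLinearMap η = 0 :=
    contractLast_eq_zero (fun m r hr => C.ε_pow m r hr) hη
  nth_rw 1 [← lastMap_id n η]
  rw [h, lastMap_add, lastMap_add, lastMap_add, lastMap_smulRight, h0, map_zero, zero_add,
    lastMap_comp, lastMap_comp, lastMap_comp]

lemma exists_barDifferential_eq {n j : ℕ} (hnj : n < j) {η : ⨂[k]^(n + 1) A}
    (hη : η ∈ barChains (fun n => C.W ^ n) (n + 1) (j + 1)) (hd : barDifferential k A n η = 0) :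
    ∃ β ∈ barChains (fun n => C.W ^ n) (n + 2) (j + 1), barDifferential k A (n + 1) β = η := by
  have : SetLike.GradedMonoid (fun n : ℕ => C.W ^ n) := Submodule.nat_power_gradedMonoid C.W
  have h1 {w : A} (hw : w ∈ C.W) : w ∈ (fun n : ℕ => C.W ^ n) 1 := by simpa using hw
  have cancel {u v : A} {D E : A →ₗ[k] A} (huv : u * v = 0)
      (h : ∀ r, r - D (r * v) = E (r - D (r * v)) * u) (n : ℕ) (t : ⨂[k]^(n + 1) A) :
      lastMap n (LinearMap.mulRight k v) (lastMap n D (lastMap n (LinearMap.mulRight k v) t)) =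
        lastMap n (LinearMap.mulRight k v) t := by
    rw [lastMap_comp, lastMap_comp]
    congr 2
    refine LinearMap.ext fun r => ?_
    have := congrArg (· * v) (h r)
    simp only [sub_mul, mul_assoc, huv, mul_zero, sub_eq_zero] at this
    exact this.symm
  have kill {v : A} {D : A →ₗ[k] A} (h : ∀ r, D (r * v) = 0) (n : ℕ) (t : ⨂[k]^(n + 1) A) :
      lastMap n D (lastMap n (LinearMap.mulRight k v) t) = 0 := by
    rw [lastMap_comp]
    exact lastMap_eq_zero h t
  have part {v : A} {D : A →ₗ[k] A} (hv : v ∈ C.W)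
      (H : MultipleCyclesBound (fun n => C.W ^ n) v D)
      (hDm : ∀ m : ℕ, ∀ r ∈ C.W ^ (m + 1), D r ∈ C.W ^ m)
      (hDD : lastMap n (LinearMap.mulRight k v) (lastMap n D
        (lastMap n (LinearMap.mulRight k v) (lastMap n D η))) =
          lastMap n (LinearMap.mulRight k v) (lastMap n D η))
      (hDd : barDifferential k A n (lastMap n (LinearMap.mulRight k v) (lastMap n D η)) = 0) :
      ∃ β ∈ barChains (fun n => C.W ^ n) (n + 2) (j + 1), barDifferential k A (n + 1) β =
        lastMap n (LinearMap.mulRight k v) (lastMap n D η) := by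
    have hm : lastMap n (LinearMap.mulRight k v) (lastMap n D η) ∈
        barChains (fun n => C.W ^ n) (n + 1) (j + 1) := by
      rw [lastMap_comp]
      exact lastMap_mem_barChains_of_mapsTo
        (fun m r hr => SetLike.mul_mem_graded (A := fun n : ℕ => C.W ^ n) (hDm m r hr) (h1 hv)) hη
    obtain ⟨β, hβ, hdβ⟩ := H n j hnj _ hm hDd hDD
    exact ⟨_, tensorSnoc_mem_barChains (h1 hv) hβ, hdβ⟩
  -- The differential commutes with right multiplication on the last factor, so the three components
  -- of `d η` lie in the independent parts `A b`, `A c`, `A d` and vanish separately.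
  have hcyc :
      barDifferential k A n (lastMap n (LinearMap.mulRight k C.b) (lastMap n C.Db η)) = 0 ∧
      barDifferential k A n (lastMap n (LinearMap.mulRight k C.c) (lastMap n C.Dc η)) = 0 ∧
      barDifferential k A n (lastMap n (LinearMap.mulRight k C.d) (lastMap n C.Dd η)) = 0 := by
    obtain _ | m := n
    · simp [barDifferential_zero]
    rw [C.lastMap_decomp hη, map_add, map_add] at hd
    simp only [barDifferential_lastMap] at hd ⊢
    refine ⟨?_, ?_, ?_⟩
    · have := congrArg (fun t => lastMap m (LinearMap.mulRight k C.b) (lastMap m C.Db t)) hd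
      simpa only [map_add, map_zero, cancel C.ab C.Db_b, kill C.Db_c, kill C.Db_d, add_zero]
        using this
    · have := congrArg (fun t => lastMap m (LinearMap.mulRight k C.c) (lastMap m C.Dc t)) hd
      simpa only [map_add, map_zero, cancel C.bc C.Dc_c, kill C.Dc_b, kill C.Dc_d, add_zero,
        zero_add] using this
    · have := congrArg (fun t => lastMap m (LinearMap.mulRight k C.d) (lastMap m C.Dd t)) hd
      simpa only [map_add, map_zero, cancel C.cd C.Dd_d, kill C.Dd_b, kill C.Dd_c, add_zero,
        zero_add] using this
  obtain ⟨Hb, Hc, Hd⟩ := C.multipleCyclesBound_bcd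
  obtain ⟨β₁, hβ₁, hd₁⟩ := part C.b_mem Hb C.Db_pow (cancel C.ab C.Db_b n _) hcyc.1
  obtain ⟨β₂, hβ₂, hd₂⟩ := part C.c_mem Hc C.Dc_pow (cancel C.bc C.Dc_c n _) hcyc.2.1
  obtain ⟨β₃, hβ₃, hd₃⟩ := part C.d_mem Hd C.Dd_pow (cancel C.cd C.Dd_d n _) hcyc.2.2
  refine ⟨β₁ + β₂ + β₃, add_mem (add_mem hβ₁ hβ₂) hβ₃, ?_⟩
  rw [map_add, map_add, hd₁, hd₂, hd₃]
  exact (C.lastMap_decomp hη).symm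

theorem subsingleton_barHomology {n j : ℕ} (hnj : n ≠ j) :
    Subsingleton (BarHomology (fun n => C.W ^ n) n j) := by
  rw [Submodule.Quotient.subsingleton_iff, Submodule.comap_subtype_eq_top]
  intro η hη
  have hm : η ∈ barChains (fun n => C.W ^ n) n j := by
    obtain _ | n := n
    · exact hη
    · exact hη.1
  rcases hnj.lt_or_gt with h | h
  · obtain _ | n := n
    · rw [barChains_zero_eq_bot h, Submodule.mem_bot] at hm
      exact hm ▸ zero_mem _
    · obtain _ | j := j
      · omega
      obtain ⟨β, hβ, rfl⟩ := C.exists_barDifferential_eq (by omega) hm hη.2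
      exact ⟨β, hβ, rfl⟩
  · rw [barChains_eq_bot_of_lt h, Submodule.mem_bot] at hm
    exact hm ▸ zero_mem _

end AnnihilatorChain

/-! ### Normal words -/

/-- Whether a normal word stays normal when a letter is put in front of it. The excluded subwords
are `b c`, `c d`, `d b` and `c e b`, with `b`, `c`, `d` the letters `0`, `1`, `2`. -/
def allowed (e : Fin 3) : Fin 3 → List (Fin 3) → Bool
  | 0, 1 :: _ => false
  | 1, 2 :: _ => false
  | 1, x :: 0 :: _ => x ≠ e
  | 2, 0 :: _ => false
  | _, _ => true

/-- Whether a word in the letters `0`, `1`, `2` is normal. -/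
def normal (e : Fin 3) : List (Fin 3) → Bool
  | [] => true
  | i :: u => allowed e i u && normal e u

/-- Left multiplication of normal words by a letter, subject to `d b = l • e b`. -/
noncomputable def letterMulWord {k : Type*} [Field k] (e : Fin 3) (l : k) (i : Fin 3)
    (u : List (Fin 3)) : List (Fin 3) →₀ k :=
  if allowed e i u then Finsupp.single (i :: u) 1
  else if i = 2 then Finsupp.single (e :: u) l else 0

/-- The linear extension of `letterMulWord`. -/
noncomputable def letterMul {k : Type*} [Field k] (e : Fin 3) (l : k) (i : Fin 3) :
    Module.End k (List (Fin 3) →₀ k) :=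
  Finsupp.linearCombination k (letterMulWord e l i)

section LetterMul

variable {k : Type*} [Field k] {e : Fin 3} {l : k}

lemma letterMul_single (i : Fin 3) (u : List (Fin 3)) (x : k) :
    letterMul e l i (Finsupp.single u x) = x • letterMulWord e l i u :=
  Finsupp.linearCombination_single _ _ _

lemma letterMulWord_of_allowed {i : Fin 3} {u : List (Fin 3)} (h : allowed e i u) :
    letterMulWord e l i u = Finsupp.single (i :: u) 1 :=
  if_pos h

lemma letterMulWord_of_not_allowed {i : Fin 3} {u : List (Fin 3)} (h : ¬ allowed e i u)
    (hi : i ≠ 2) : letterMulWord e l i u = 0 := by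
  rw [letterMulWord, if_neg h, if_neg hi]

lemma letterMulWord_two_zero (u : List (Fin 3)) :
    letterMulWord e l 2 (0 :: u) = Finsupp.single (e :: 0 :: u) l := by
  simp [letterMulWord, allowed]

lemma allowed_two {u : List (Fin 3)} (h : ¬ allowed e 2 u) : ∃ v, u = 0 :: v := by
  match u, h with
  | 0 :: v, _ => exact ⟨v, rfl⟩
  | [], h => simp [allowed] at h
  | 1 :: v, h => simp [allowed] at h
  | 2 :: v, h => simp [allowed] at h

lemma allowed_zero_one (u : List (Fin 3)) : ¬ allowed e 0 (1 :: u) := by simp [allowed]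

lemma allowed_one_two (u : List (Fin 3)) : ¬ allowed e 1 (2 :: u) := by simp [allowed]

lemma allowed_one_e_zero (he : e ≠ 2) (u : List (Fin 3)) : ¬ allowed e 1 (e :: 0 :: u) := by
  fin_cases e <;> simp_all [allowed]

lemma allowed_e_zero (he : e ≠ 2) (u : List (Fin 3)) : allowed e e (0 :: u) := by
  fin_cases e
  · simp [allowed]
  · rcases u with _ | ⟨x, u⟩
    · simp [allowed]
    · fin_cases x <;> simp [allowed]
  · exact absurd rfl he

/-- The operators act on all words, and each relation is visible in the leading letters, so it holds
without restricting to normal words. This action takes the place of a confluence argument. -/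
lemma letterMul_zero_one : letterMul e l 0 * letterMul e l 1 = 0 := by
  refine Finsupp.lhom_ext' fun u => LinearMap.ext_ring ?_
  change letterMul e l 0 (letterMul e l 1 (Finsupp.single u 1)) = 0
  rw [letterMul_single, one_smul]
  by_cases h : allowed e 1 u
  · rw [letterMulWord_of_allowed h, letterMul_single, one_smul,
      letterMulWord_of_not_allowed (allowed_zero_one u) (by decide)]
  · rw [letterMulWord_of_not_allowed h (by decide), map_zero]

/-- If the word starts with `b`, then `d` turns into `l • e`, and `c` kills the result exactly
because `c e b` is excluded. -/
lemma letterMul_one_two (he : e ≠ 2) : letterMul e l 1 * letterMul e l 2 = 0 := by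
  refine Finsupp.lhom_ext' fun u => LinearMap.ext_ring ?_
  change letterMul e l 1 (letterMul e l 2 (Finsupp.single u 1)) = 0
  rw [letterMul_single, one_smul]
  by_cases h : allowed e 2 u
  · rw [letterMulWord_of_allowed h, letterMul_single, one_smul,
      letterMulWord_of_not_allowed (allowed_one_two u) (by decide)]
  · obtain ⟨v, rfl⟩ := allowed_two h
    rw [letterMulWord_two_zero, letterMul_single,
      letterMulWord_of_not_allowed (allowed_one_e_zero he v) (by decide), smul_zero]

lemma letterMul_two_zero (he : e ≠ 2) :
    letterMul e l 2 * letterMul e l 0 = l • (letterMul e l e * letterMul e l 0) := by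
  refine Finsupp.lhom_ext' fun u => LinearMap.ext_ring ?_
  change letterMul e l 2 (letterMul e l 0 (Finsupp.single u 1)) =
    l • letterMul e l e (letterMul e l 0 (Finsupp.single u 1))
  rw [letterMul_single, one_smul]
  by_cases h : allowed e 0 u
  · rw [letterMulWord_of_allowed h, letterMul_single, one_smul, letterMulWord_two_zero,
      letterMul_single, letterMulWord_of_allowed (allowed_e_zero he u), one_smul]
    simp
  · rw [letterMulWord_of_not_allowed h (by decide), map_zero, map_zero, smul_zero]

lemma letterMul_nil (i : Fin 3) :
    letterMul e l i (Finsupp.single [] 1) = Finsupp.single [i] 1 := by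
  rw [letterMul_single, one_smul, letterMulWord_of_allowed (by fin_cases i <;> simp [allowed])]

/-- `letterMul` preserves the span of a set of words closed under prepending letters. -/
lemma letterMul_mem_supported {s t : Set (List (Fin 3))} (h : ∀ i, ∀ u ∈ s, i :: u ∈ t)
    (i : Fin 3) {f : List (Fin 3) →₀ k} (hf : f ∈ Finsupp.supported k k s) :
    letterMul e l i f ∈ Finsupp.supported k k t := by
  rw [Finsupp.supported_eq_span_single] at hf
  induction hf using Submodule.span_induction with
  | mem f hf =>
    obtain ⟨u, hu, rfl⟩ := hf
    rw [letterMul_single, one_smul, letterMulWord]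
    split_ifs
    · exact Finsupp.single_mem_supported k _ (h _ _ hu)
    · exact Finsupp.single_mem_supported k _ (h _ _ hu)
    · exact zero_mem _
  | zero => simp
  | add f g _ _ hf hg => rw [map_add]; exact add_mem hf hg
  | smul x f _ hf => rw [map_smul]; exact Submodule.smul_mem _ x hf

/-- Removing the letter `j` from the end of words, where words not ending in `j` go to `0`. -/
noncomputable def dropEnd (k : Type*) [Field k] (j : Fin 3) :
    (List (Fin 3) →₀ k) →ₗ[k] (List (Fin 3) →₀ k) :=
  Finsupp.linearCombination k fun u =>
    if u.getLast? = some j then Finsupp.single u.dropLast 1 else 0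

lemma dropEnd_concat (j : Fin 3) (u : List (Fin 3)) :
    dropEnd k j (Finsupp.single (u ++ [j]) 1) = Finsupp.single u 1 := by
  simp [dropEnd]

lemma dropEnd_single_of_ne {j : Fin 3} {u : List (Fin 3)} (h : u.getLast? ≠ some j) :
    dropEnd k j (Finsupp.single u 1) = 0 := by
  simp [dropEnd, h]

lemma dropEnd_mem_supported (j : Fin 3) {n : ℕ} {f : List (Fin 3) →₀ k}
    (hf : f ∈ Finsupp.supported k k {u : List (Fin 3) | u.length = n + 1}) :
    dropEnd k j f ∈ Finsupp.supported k k {u : List (Fin 3) | u.length = n} := by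
  rw [Finsupp.supported_eq_span_single] at hf
  induction hf using Submodule.span_induction with
  | mem f hf =>
    obtain ⟨u, hu, rfl⟩ := hf
    by_cases h : u.getLast? = some j
    · obtain ⟨v, rfl⟩ := List.getLast?_eq_some_iff.1 h
      rw [dropEnd_concat]
      exact Finsupp.single_mem_supported k _ (by simpa using hu)
    · rw [dropEnd_single_of_ne h]
      exact zero_mem _
  | zero => simp
  | add f g _ _ hf hg => rw [map_add]; exact add_mem hf hg
  | smul x f _ hf => rw [map_smul]; exact Submodule.smul_mem _ x hf

/-- A letter put after `x` can only be felt by `i` through the excluded word `c e b`, that is, when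
`x = e` and `j = 0`. -/
lemma allowed_append {i x j : Fin 3} (u : List (Fin 3)) (h : allowed e i (u ++ [x]))
    (hx : x = e → j ≠ 0) : allowed e i (u ++ [x, j]) := by
  rcases u with _ | ⟨y, _ | ⟨z, u⟩⟩
  · fin_cases i <;> fin_cases x <;> fin_cases j <;> simp_all [allowed, eq_comm]
  · fin_cases i <;> fin_cases y <;> fin_cases x <;> simp_all [allowed]
  · fin_cases i <;> fin_cases y <;> fin_cases z <;> simp_all [allowed]

lemma allowed_cons_cons (i x y : Fin 3) (u v : List (Fin 3)) :
    allowed e i (x :: y :: u) = allowed e i (x :: y :: v) := by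
  fin_cases i <;> fin_cases x <;> fin_cases y <;> rfl

lemma normal_append {x j : Fin 3} (u : List (Fin 3)) (h : normal e (u ++ [x]))
    (hx : x = e → j ≠ 0) (hxj : allowed e x [j]) : normal e (u ++ [x, j]) := by
  induction u with
  | nil => simp_all [normal]; fin_cases j <;> simp [allowed]
  | cons i u ih =>
    simp only [List.cons_append, normal, Bool.and_eq_true] at h ⊢
    exact ⟨allowed_append u h.1 hx, ih h.2⟩

end LetterMul

/-! ### Normal forms, right division and left annihilators in a word model. -/

/-- An algebra presented by generators `b`, `c`, `d` (namely `g 0`, `g 1`, `g 2`) and relations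
`b c = 0`, `c d = 0`, `d b = l • e b`, with `e` one of `b`, `c` and `l ≠ 0`, together with its action
on words. -/
structure WordModel (k R : Type*) [Field k] [Ring R] [Algebra k R] where
  g : Fin 3 → R
  e : Fin 3
  l : k
  he : e ≠ 2
  hl : l ≠ 0
  g_zero_one : g 0 * g 1 = 0
  g_one_two : g 1 * g 2 = 0
  g_two_zero : g 2 * g 0 = l • (g e * g 0)
  adjoin_g : Algebra.adjoin k (Set.range g) = ⊤
  toEnd : R →ₐ[k] Module.End k (List (Fin 3) →₀ k)
  toEnd_g : ∀ i, toEnd (g i) = letterMul e l i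
  ε : R →ₐ[k] k
  ε_g : ∀ i, ε (g i) = 0

namespace WordModel

variable {k R : Type*} [Field k] [Ring R] [Algebra k R] (P : WordModel k R)

/-- The element represented by a word. -/
def mon (u : List (Fin 3)) : R := (u.map P.g).prod

/-- The expansion of an element in normal words. -/
noncomputable def expand : R →ₗ[k] (List (Fin 3) →₀ k) :=
  LinearMap.applyₗ (Finsupp.single [] 1) ∘ₗ P.toEnd.toLinearMap

/-- The evaluation of a combination of words. -/
noncomputable def eval : (List (Fin 3) →₀ k) →ₗ[k] R :=
  Finsupp.linearCombination k P.mon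

@[simp] lemma mon_nil : P.mon [] = 1 := rfl

@[simp] lemma mon_cons (i : Fin 3) (u : List (Fin 3)) : P.mon (i :: u) = P.g i * P.mon u := by
  simp [mon]

@[simp] lemma mon_append (u v : List (Fin 3)) : P.mon (u ++ v) = P.mon u * P.mon v := by
  simp [mon]

@[simp] lemma eval_single (u : List (Fin 3)) (x : k) :
    P.eval (Finsupp.single u x) = x • P.mon u := by
  simp [eval]

lemma expand_mul (r s : R) : P.expand (r * s) = P.toEnd r (P.expand s) := by
  simp [expand]

lemma expand_g_mul (i : Fin 3) (r : R) :
    P.expand (P.g i * r) = letterMul P.e P.l i (P.expand r) := by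
  rw [expand_mul, toEnd_g]

lemma expand_one : P.expand 1 = Finsupp.single [] 1 := by
  simp [expand]

/-- Normal words are thus linearly independent; with `span_normal` they form a basis. -/
lemma expand_mon {u : List (Fin 3)} (hu : normal P.e u) :
    P.expand (P.mon u) = Finsupp.single u 1 := by
  induction u with
  | nil => exact P.expand_one
  | cons i u ih =>
    simp only [normal, Bool.and_eq_true] at hu
    rw [mon_cons, expand_g_mul, ih hu.2, letterMul_single, one_smul,
      letterMulWord_of_allowed hu.1]

/-- The overlap `c d b` evaluated in two ways, with `l` invertible. -/
lemma g_one_mul_e_mul_zero : P.g 1 * (P.g P.e * P.g 0) = 0 := by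
  have h : P.l • (P.g 1 * (P.g P.e * P.g 0)) = 0 := by
    rw [← mul_smul_comm, ← P.g_two_zero, ← mul_assoc, P.g_one_two, zero_mul]
  exact (smul_eq_zero.1 h).resolve_left P.hl

lemma g_mul_mon {i : Fin 3} {u : List (Fin 3)} (h : ¬ allowed P.e i u) (hi : i ≠ 2) :
    P.g i * P.mon u = 0 := by
  match i, u, h with
  | 0, [], h | 0, 0 :: _, h | 0, 2 :: _, h => simp [allowed] at h
  | 0, 1 :: u, _ => rw [mon_cons, ← mul_assoc, P.g_zero_one, zero_mul]
  | 1, 2 :: u, _ => rw [mon_cons, ← mul_assoc, P.g_one_two, zero_mul]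
  | 1, [], h | 1, [0], h | 1, [1], h => simp [allowed] at h
  | 1, 0 :: 1 :: _, h | 1, 0 :: 2 :: _, h | 1, 1 :: 1 :: _, h | 1, 1 :: 2 :: _, h =>
    simp [allowed] at h
  | 1, 0 :: 0 :: u, h =>
    have : (0 : Fin 3) = P.e := by simpa [allowed] using h
    have h0 := P.g_one_mul_e_mul_zero
    rw [← this] at h0
    rw [mon_cons, mon_cons, ← mul_assoc (P.g 0), ← mul_assoc, h0, zero_mul]
  | 1, 1 :: 0 :: u, h =>
    have : (1 : Fin 3) = P.e := by simpa [allowed] using h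
    have h0 := P.g_one_mul_e_mul_zero
    rw [← this] at h0
    rw [mon_cons, mon_cons, ← mul_assoc (P.g 1) (P.g 0), ← mul_assoc, h0, zero_mul]
  | 2, _, _ => exact absurd rfl hi

lemma g_two_mul_mon (u : List (Fin 3)) :
    P.g 2 * P.mon (0 :: u) = P.l • P.mon (P.e :: 0 :: u) := by
  rw [mon_cons, mon_cons, mon_cons, ← mul_assoc, P.g_two_zero, smul_mul_assoc, mul_assoc]

/-- A subspace containing `1` and closed under left multiplication by generators is everything. -/
lemma eq_top_of_left_closed {N : Submodule k R} (h1 : 1 ∈ N) (h : ∀ i, ∀ r ∈ N, P.g i * r ∈ N) :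
    N = ⊤ := by
  have key : ∀ r ∈ Algebra.adjoin k (Set.range P.g), ∀ s ∈ N, r * s ∈ N := by
    intro r hr
    induction hr using Algebra.adjoin_induction with
    | mem r hr =>
      obtain ⟨i, rfl⟩ := hr
      exact h i
    | algebraMap x => exact fun s hs => by rw [← Algebra.smul_def]; exact N.smul_mem x hs
    | add r s _ _ hr hs => exact fun t ht => by rw [add_mul]; exact add_mem (hr t ht) (hs t ht)
    | mul r s _ _ hr hs => exact fun t ht => by rw [mul_assoc]; exact hr _ (hs t ht)
  rw [eq_top_iff]
  intro r _
  simpa using key r (P.adjoin_g ▸ Algebra.mem_top) 1 h1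

lemma normal_e_cons {v : List (Fin 3)} (h : normal P.e (0 :: v)) :
    normal P.e (P.e :: 0 :: v) := by
  rw [normal, Bool.and_eq_true]
  exact ⟨allowed_e_zero P.he v, h⟩

lemma span_normal : Submodule.span k (P.mon '' {u | normal P.e u}) = ⊤ := by
  refine P.eq_top_of_left_closed (Submodule.subset_span ⟨[], rfl, rfl⟩) fun i r hr => ?_
  induction hr using Submodule.span_induction with
  | mem r hr =>
    obtain ⟨u, hu, rfl⟩ := hr
    by_cases h : allowed P.e i u
    · rw [← mon_cons]
      exact Submodule.subset_span ⟨i :: u, by simp_all [normal], rfl⟩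
    · by_cases hi : i = 2
      · subst hi
        obtain ⟨v, rfl⟩ := allowed_two h
        rw [g_two_mul_mon]
        exact Submodule.smul_mem _ _ (Submodule.subset_span ⟨_, P.normal_e_cons hu, rfl⟩)
      · rw [P.g_mul_mon h hi]
        exact zero_mem _
  | zero => simp
  | add r s _ _ hr hs => rw [mul_add]; exact add_mem hr hs
  | smul x r _ hr => rw [mul_smul_comm]; exact Submodule.smul_mem _ x hr

/-- Linear maps agreeing on normal words are equal. -/
lemma hom_ext {N : Type*} [AddCommGroup N] [Module k N] {f f' : R →ₗ[k] N}
    (h : ∀ u, normal P.e u → f (P.mon u) = f' (P.mon u)) : f = f' := by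
  refine LinearMap.ext_on P.span_normal ?_
  rintro _ ⟨u, hu, rfl⟩
  exact h u hu

/-- Division by the generator `g j` from the right. -/
noncomputable def div (j : Fin 3) : R →ₗ[k] R := P.eval ∘ₗ dropEnd k j ∘ₗ P.expand

lemma div_one (j : Fin 3) : P.div j 1 = 0 := by
  simp only [div, LinearMap.comp_apply, expand_one]
  rw [dropEnd_single_of_ne (by simp), map_zero]

lemma div_mon_mul {j : Fin 3} {u : List (Fin 3)} (h : normal P.e (u ++ [j])) :
    P.div j (P.mon u * P.g j) = P.mon u := by
  have : P.mon u * P.g j = P.mon (u ++ [j]) := by simp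
  rw [this, div, LinearMap.comp_apply, LinearMap.comp_apply, P.expand_mon h, dropEnd_concat,
    eval_single, one_smul]

/-- Left multiplication never alters the last letter of a nonempty word, so every word in the
expansion of `r * g i` ends in `i`. -/
lemma div_mul_of_ne {i j : Fin 3} (hij : i ≠ j) (r : R) : P.div j (r * P.g i) = 0 := by
  set s : Set (List (Fin 3)) := {u | u.getLast? = some i} with hs
  have hN : (Finsupp.supported k k s).comap (P.expand ∘ₗ LinearMap.mulRight k (P.g i)) = ⊤ := by
    refine P.eq_top_of_left_closed ?_ fun m r hr => ?_
    · rw [Submodule.mem_comap, LinearMap.comp_apply, LinearMap.mulRight_apply, one_mul,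
        ← mul_one (P.g i), expand_g_mul, expand_one, letterMul_nil]
      exact Finsupp.single_mem_supported k _ (by simp [hs])
    · rw [Submodule.mem_comap, LinearMap.comp_apply, LinearMap.mulRight_apply] at hr ⊢
      rw [mul_assoc, expand_g_mul]
      refine letterMul_mem_supported (s := s) (fun m u hu => ?_) m hr
      rw [hs, Set.mem_ofPred_eq] at hu ⊢
      rw [List.getLast?_cons, hu]
      rfl
  rw [div, LinearMap.comp_apply, LinearMap.comp_apply]
  have hr : P.expand (r * P.g i) ∈ Finsupp.supported k k s := by
    have : r ∈ (Finsupp.supported k k s).comap (P.expand ∘ₗ LinearMap.mulRight k (P.g i)) :=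
      hN ▸ Submodule.mem_top
    exact this
  generalize P.expand (r * P.g i) = f at hr
  rw [Finsupp.supported_eq_span_single] at hr
  have h0 : dropEnd k j f = 0 := by
    induction hr using Submodule.span_induction with
    | mem f hf =>
      obtain ⟨u, hu, rfl⟩ := hf
      exact dropEnd_single_of_ne (by rw [hu]; simpa using hij)
    | zero => simp
    | add f g _ _ hf hg => rw [map_add, hf, hg, add_zero]
    | smul x f _ hf => rw [map_smul, hf, smul_zero]
  rw [h0, map_zero]

lemma decomp (r : R) : r = algebraMap k R (P.ε r) + P.div 0 r * P.g 0 + P.div 1 r * P.g 1 +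
    P.div 2 r * P.g 2 := by
  have h : (LinearMap.id : R →ₗ[k] R) = Algebra.linearMap k R ∘ₗ P.ε.toLinearMap +
      LinearMap.mulRight k (P.g 0) ∘ₗ P.div 0 + LinearMap.mulRight k (P.g 1) ∘ₗ P.div 1 +
      LinearMap.mulRight k (P.g 2) ∘ₗ P.div 2 := by
    refine P.hom_ext fun u hu => ?_
    rcases List.eq_nil_or_concat' u with rfl | ⟨v, i, rfl⟩
    · simp [div_one]
    · have h1 := P.div_mon_mul hu
      have h2 {j : Fin 3} (hj : i ≠ j) := P.div_mul_of_ne hj (P.mon v)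
      fin_cases i <;> simp_all [ε_g]
  exact LinearMap.congr_fun h r

/-- The element `d - l • e`, which annihilates `b` from the left. -/
def ann : R := P.g 2 - P.l • P.g P.e

lemma ann_mul : P.ann * P.g 0 = 0 := by
  rw [ann, sub_mul, P.g_two_zero, smul_mul_assoc, sub_self]

/-- The left annihilator of `g j` is generated by `annGen j`, which is `d - l • e`, `b`, `c`
for `j = 0, 1, 2`. -/
def annGen : Fin 3 → R
  | 0 => P.ann
  | 1 => P.g 0
  | 2 => P.g 1

lemma annGen_mul (j : Fin 3) : P.annGen j * P.g j = 0 := by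
  fin_cases j
  · exact P.ann_mul
  · exact P.g_zero_one
  · exact P.g_one_two

/-- This determines the annihilator of `g j`: right multiplication by `g j` is injective on the
first summand, since it sends normal words to distinct normal words, and kills the second. The sum
is closed under left multiplication because appending `j` creates an excluded word only in the short
cases `hnil` and `hsingle`. -/
lemma span_sup_range (j : Fin 3) :
    Submodule.span k (P.mon '' {u | normal P.e (u ++ [j])}) ⊔
      LinearMap.range (LinearMap.mulRight k (P.annGen j)) = ⊤ := by
  set U := Submodule.span k (P.mon '' {u | normal P.e (u ++ [j])}) with hU
  set V := LinearMap.range (LinearMap.mulRight k (P.annGen j)) with hV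
  have memU {u} (hu : normal P.e (u ++ [j])) : P.mon u ∈ U ⊔ V :=
    Submodule.mem_sup_left (Submodule.subset_span ⟨u, hu, rfl⟩)
  have memV (r : R) : r * P.annGen j ∈ U ⊔ V := Submodule.mem_sup_right ⟨r, rfl⟩
  have hnil (i : Fin 3) (h : ¬ allowed P.e i [j]) : P.g i * P.mon [] ∈ U ⊔ V := by
    have hV := memV 1
    rw [one_mul] at hV
    rw [mon_nil, mul_one]
    match i, j, h with
    | 0, 1, _ | 1, 2, _ => exact hV
    | 2, 0, _ =>
      have he : P.g P.e ∈ U ⊔ V := by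
        simpa using memU (u := [P.e]) (P.normal_e_cons (v := []) (by simp [normal, allowed]))
      have h2 : P.g 2 = P.annGen 0 + P.l • P.g P.e := by simp [annGen, ann]
      rw [h2]
      exact add_mem hV (Submodule.smul_mem _ _ he)
    | 0, 0, h | 0, 2, h | 1, 0, h | 1, 1, h | 2, 1, h | 2, 2, h => simp [allowed] at h
  -- The only obstruction of length three is `c e b`, and `c e` is a multiple of `c (d - l • e)`
  -- since `c d = 0`.
  have hsingle (i x : Fin 3) (h : ¬ allowed P.e i [x, j]) (h' : allowed P.e i [x]) :
      P.g i * P.mon [x] ∈ U ⊔ V := by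
    obtain ⟨rfl, rfl, rfl⟩ : i = 1 ∧ x = P.e ∧ j = 0 := by
      clear_value U V
      clear hnil memU memV hU hV
      have := P.he
      generalize P.e = e at *
      revert i x j e
      decide
    have h1 : P.g 1 * P.mon [P.e] = (-P.l⁻¹) • (P.g 1 * P.annGen 0) := by
      simp [annGen, ann, mul_sub, P.g_one_two, smul_smul, P.hl]
    rw [h1]
    exact Submodule.smul_mem _ _ (memV _)
  refine P.eq_top_of_left_closed (memU (u := []) ?_) fun i r hr => ?_
  · fin_cases j <;> simp [normal, allowed]
  obtain ⟨q, hq, _, ⟨s, rfl⟩, rfl⟩ := Submodule.mem_sup.1 hr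
  clear hr
  rw [mul_add, LinearMap.mulRight_apply, ← mul_assoc]
  refine add_mem ?_ (memV _)
  induction hq using Submodule.span_induction with
  | mem r hr =>
    obtain ⟨u, hu, rfl⟩ := hr
    rw [Set.mem_ofPred_eq] at hu
    by_cases h : allowed P.e i (u ++ [j])
    · rw [← mon_cons]
      exact memU (by rw [List.cons_append, normal, h, hu]; rfl)
    by_cases h' : allowed P.e i u
    · match u, h, h' with
      | [], h, _ => exact hnil i h
      | [x], h, h' => exact hsingle i x h h'
      -- Prepending inspects only two letters, so the appended `j` goes unnoticed.
      | x :: y :: u, h, h' =>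
        exact absurd ((allowed_cons_cons i x y u _).symm.trans h') h
    · by_cases hi : i = 2
      · subst hi
        obtain ⟨v, rfl⟩ := allowed_two h'
        rw [g_two_mul_mon]
        exact Submodule.smul_mem _ _ (memU (P.normal_e_cons hu))
      · rw [P.g_mul_mon h' hi]
        exact zero_mem _
  | zero => simp
  | add r s _ _ hr hs => rw [mul_add]; exact add_mem hr hs
  | smul x r _ hr => rw [mul_smul_comm]; exact Submodule.smul_mem _ x hr

/-- Multiplying by `g j` and dividing back is the identity on the first summand of `span_sup_range`
and zero on the second, so the difference lies in `R * annGen j`, where `E` divides. -/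
lemma sub_div_mul (j : Fin 3) {E : R →ₗ[k] R}
    (hE : ∀ r, E (r * P.annGen j) * P.annGen j = r * P.annGen j) (r : R) :
    r - P.div j (r * P.g j) = E (r - P.div j (r * P.g j)) * P.annGen j := by
  have hr : r - P.div j (r * P.g j) ∈ LinearMap.range (LinearMap.mulRight k (P.annGen j)) := by
    have hr : r ∈ Submodule.span k (P.mon '' {u | normal P.e (u ++ [j])}) ⊔
        LinearMap.range (LinearMap.mulRight k (P.annGen j)) :=
      P.span_sup_range j ▸ Submodule.mem_top
    obtain ⟨q, hq, _, ⟨s, rfl⟩, rfl⟩ := Submodule.mem_sup.1 hr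
    rw [LinearMap.mulRight_apply, add_mul, mul_assoc, P.annGen_mul, mul_zero, add_zero]
    have : P.div j (q * P.g j) = q := by
      clear hr
      induction hq using Submodule.span_induction with
      | mem r hr =>
        obtain ⟨u, hu, rfl⟩ := hr
        exact P.div_mon_mul hu
      | zero => simp
      | add r s _ _ hr hs => rw [add_mul, map_add, hr, hs]
      | smul x r _ hr => rw [smul_mul_assoc, map_smul, hr]
    rw [this, add_sub_cancel_left]
    exact ⟨s, rfl⟩
  obtain ⟨s, hs⟩ := hr
  rw [← hs, LinearMap.mulRight_apply, hE]

/-- Division by `d - l • e` from the right. -/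
noncomputable def divAnn : R →ₗ[k] R :=
  -- For a normal `u` with `u d` normal, the `d`-part of `u (d - l • e)` already recovers `u`.
  -- Otherwise `u` ends in `c`, the product is `-l • u e`, and the correction term recovers `u`.
  P.div 2 - P.l⁻¹ • P.div P.e ∘ₗ (LinearMap.id - LinearMap.mulRight k P.ann ∘ₗ P.div 2)

lemma divAnn_apply (r : R) :
    P.divAnn r = P.div 2 r - P.l⁻¹ • P.div P.e (r - P.div 2 r * P.ann) := rfl

lemma divAnn_mul (r : R) : P.divAnn (r * P.ann) = r := by
  have h : P.divAnn ∘ₗ LinearMap.mulRight k P.ann = LinearMap.id := by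
    refine P.hom_ext fun u hu => ?_
    rw [LinearMap.comp_apply, LinearMap.mulRight_apply, LinearMap.id_apply, divAnn_apply]
    have h2 : P.div 2 (P.mon u * P.ann) = P.div 2 (P.mon u * P.g 2) := by
      rw [ann, mul_sub, map_sub, mul_smul_comm, map_smul, P.div_mul_of_ne P.he, smul_zero,
        sub_zero]
    by_cases hu2 : normal P.e (u ++ [2])
    · rw [h2, P.div_mon_mul hu2, sub_self, map_zero, smul_zero, sub_zero]
    · rcases List.eq_nil_or_concat' u with rfl | ⟨v, i, rfl⟩
      · simp [normal, allowed] at hu2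
      have hi : i = 1 := by
        by_contra hi
        refine hu2 ?_
        rw [List.append_assoc]
        refine normal_append v hu (fun _ => by decide) ?_
        fin_cases i <;> simp_all [allowed]
      subst hi
      have hue : normal P.e (v ++ [1, P.e]) :=
        normal_append v hu (fun h => by rw [← h]; decide) (by
          have := P.he
          generalize P.e = e at *
          fin_cases e <;> simp_all [allowed])
      have h0 : P.mon (v ++ [1]) * P.g 2 = 0 := by simp [mul_assoc, P.g_one_two]
      rw [h2, h0, map_zero, zero_mul, sub_zero, zero_sub, ann, mul_sub, h0, zero_sub, map_neg,
        mul_smul_comm, map_smul, P.div_mon_mul (by simpa using hue), smul_neg, neg_neg, smul_smul,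
        inv_mul_cancel₀ P.hl, one_smul]
  exact LinearMap.congr_fun h r

end WordModel

/-! ### Degrees, and the annihilator chain of a word model. -/

namespace WordModel

variable {k R : Type*} [Field k] [Ring R] [Algebra k R] (P : WordModel k R)

/-- The span of the generators. -/
def genSpan : Submodule k R := Submodule.span k (Set.range P.g)

lemma g_mem (i : Fin 3) : P.g i ∈ P.genSpan := Submodule.subset_span ⟨i, rfl⟩

lemma ann_mem : P.ann ∈ P.genSpan :=
  sub_mem (P.g_mem 2) (P.genSpan.smul_mem _ (P.g_mem P.e))

lemma ε_mem (w : R) (hw : w ∈ P.genSpan) : P.ε w = 0 := by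
  induction hw using Submodule.span_induction with
  | mem w hw =>
    obtain ⟨i, rfl⟩ := hw
    exact P.ε_g i
  | zero => simp
  | add v w _ _ hv hw => rw [map_add, hv, hw, add_zero]
  | smul x w _ hw => rw [map_smul, hw, smul_zero]

lemma iSup_genSpan_pow : ⨆ n : ℕ, P.genSpan ^ n = ⊤ := by
  refine P.eq_top_of_left_closed
    (Submodule.mem_iSup_of_mem 0 (by rw [pow_zero]; exact Submodule.one_le.1 le_rfl))
    fun i r hr => ?_
  induction hr using Submodule.iSup_induction' with
  | mem n r hr =>
    refine Submodule.mem_iSup_of_mem (n + 1) ?_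
    rw [pow_succ']
    exact Submodule.mul_mem_mul (P.g_mem i) hr
  | zero => simp
  | add r s _ _ hr hs => rw [mul_add]; exact add_mem hr hs

lemma expand_mem_supported {n : ℕ} {r : R} (hr : r ∈ P.genSpan ^ n) :
    P.expand r ∈ Finsupp.supported k k {u : List (Fin 3) | u.length = n} := by
  induction hr using Submodule.pow_induction_on_left' with
  | algebraMap x =>
    rw [Algebra.algebraMap_eq_smul_one, map_smul, expand_one]
    exact Submodule.smul_mem _ _ (Finsupp.single_mem_supported k _ rfl)
  | add r s n _ _ hr hs => rw [map_add]; exact add_mem hr hs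
  | mem_mul w hw n r _ hr =>
    induction hw using Submodule.span_induction with
    | mem w hw =>
      obtain ⟨i, rfl⟩ := hw
      rw [expand_g_mul]
      exact letterMul_mem_supported (fun i u hu => congrArg (· + 1) hu) i hr
    | zero => simp
    | add v w _ _ hv hw => rw [add_mul, map_add]; exact add_mem hv hw
    | smul x w _ hw => rw [smul_mul_assoc, map_smul]; exact Submodule.smul_mem _ x hw

lemma mon_mem (u : List (Fin 3)) : P.mon u ∈ P.genSpan ^ u.length := by
  induction u with
  | nil => rw [List.length_nil, pow_zero]; exact Submodule.one_le.1 le_rfl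
  | cons i u ih =>
    rw [mon_cons, List.length_cons, pow_succ']
    exact Submodule.mul_mem_mul (P.g_mem i) ih

lemma eval_mem {n : ℕ} {f : List (Fin 3) →₀ k}
    (hf : f ∈ Finsupp.supported k k {u : List (Fin 3) | u.length = n}) :
    P.eval f ∈ P.genSpan ^ n := by
  rw [Finsupp.supported_eq_span_single] at hf
  induction hf using Submodule.span_induction with
  | mem f hf =>
    obtain ⟨u, rfl, rfl⟩ := hf
    rw [eval_single, one_smul]
    exact P.mon_mem u
  | zero => simp
  | add f g _ _ hf hg => rw [map_add]; exact add_mem hf hg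
  | smul x f _ hf => rw [map_smul]; exact Submodule.smul_mem _ x hf

lemma div_mem (j : Fin 3) (n : ℕ) (r : R) (hr : r ∈ P.genSpan ^ (n + 1)) :
    P.div j r ∈ P.genSpan ^ n := by
  rw [div, LinearMap.comp_apply, LinearMap.comp_apply]
  exact P.eval_mem (dropEnd_mem_supported j (P.expand_mem_supported hr))

lemma divAnn_mem (n : ℕ) (r : R) (hr : r ∈ P.genSpan ^ (n + 1)) :
    P.divAnn r ∈ P.genSpan ^ n := by
  rw [divAnn_apply]
  refine sub_mem (P.div_mem 2 n r hr) (Submodule.smul_mem _ _ (P.div_mem _ n _ (sub_mem hr ?_)))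
  rw [pow_succ]
  exact Submodule.mul_mem_mul (P.div_mem 2 n r hr) P.ann_mem

/-- Passes to the next link: `annGen 1 = g 0` and `annGen 2 = g 1`, so this is the hypothesis of
`sub_div_mul` there. -/
lemma mul_div_mul {j : Fin 3} {E : R →ₗ[k] R}
    (h : ∀ r, r - P.div j (r * P.g j) = E (r - P.div j (r * P.g j)) * P.annGen j) (r : R) :
    P.div j (r * P.g j) * P.g j = r * P.g j := by
  have := congrArg (· * P.g j) (h r)
  simp only [sub_mul, mul_assoc, P.annGen_mul, mul_zero, sub_eq_zero] at this
  exact this.symm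

lemma sub_div_zero_mul (r : R) : r - P.div 0 (r * P.g 0) =
    P.divAnn (r - P.div 0 (r * P.g 0)) * P.ann :=
  P.sub_div_mul 0 (E := P.divAnn) (fun r => congrArg (· * P.ann) (P.divAnn_mul r)) r

lemma sub_div_one_mul (r : R) : r - P.div 1 (r * P.g 1) =
    P.div 0 (r - P.div 1 (r * P.g 1)) * P.g 0 :=
  P.sub_div_mul 1 (E := P.div 0) (P.mul_div_mul (j := 0) P.sub_div_zero_mul) r

lemma sub_div_two_mul (r : R) : r - P.div 2 (r * P.g 2) =
    P.div 1 (r - P.div 2 (r * P.g 2)) * P.g 1 :=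
  P.sub_div_mul 2 (E := P.div 1) (P.mul_div_mul (j := 1) P.sub_div_one_mul) r

/-- The chain of annihilators of the algebra. -/
noncomputable def annihilatorChain : AnnihilatorChain k R where
  a := P.ann
  b := P.g 0
  c := P.g 1
  d := P.g 2
  β := if P.e = 0 then -P.l else 0
  γ := if P.e = 1 then -P.l else 0
  δ := 1
  Da := P.divAnn
  Db := P.div 0
  Dc := P.div 1
  Dd := P.div 2
  ε := P.ε
  W := P.genSpan
  a_eq := by
    have he := P.he
    rw [ann]
    generalize P.e = e at *
    fin_cases e
    · simp; abel
    · simp; abel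
    · exact absurd rfl he
  ab := P.ann_mul
  bc := P.g_zero_one
  cd := P.g_one_two
  b_mem := P.g_mem 0
  c_mem := P.g_mem 1
  d_mem := P.g_mem 2
  ε_mem := P.ε_mem
  iSup_pow := P.iSup_genSpan_pow
  Da_one := by rw [divAnn_apply, div_one, zero_mul, sub_zero, div_one, smul_zero, sub_zero]
  Db_one := P.div_one 0
  Dc_one := P.div_one 1
  Dd_one := P.div_one 2
  Da_pow := P.divAnn_mem
  Db_pow := P.div_mem 0
  Dc_pow := P.div_mem 1
  Dd_pow := P.div_mem 2
  decomp := P.decomp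
  Db_c := P.div_mul_of_ne (by decide)
  Db_d := P.div_mul_of_ne (by decide)
  Dc_b := P.div_mul_of_ne (by decide)
  Dc_d := P.div_mul_of_ne (by decide)
  Dd_b := P.div_mul_of_ne (by decide)
  Dd_c := P.div_mul_of_ne (by decide)
  Da_a := P.divAnn_mul
  Db_b := P.sub_div_zero_mul
  Dc_c := P.sub_div_one_mul
  Dd_d := P.sub_div_two_mul

lemma linearIndependent_g : LinearIndependent k P.g := by
  refine LinearIndependent.of_comp P.expand ?_
  have : P.expand ∘ P.g = fun i => Finsupp.single [i] 1 := by
    funext i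
    rw [Function.comp_apply, ← mul_one (P.g i), expand_g_mul, expand_one, letterMul_nil]
  rw [this]
  exact (Finsupp.linearIndependent_single_one k (List (Fin 3))).comp (fun i => [i])
    fun i j h => by simpa using h

end WordModel

/-! ### The algebra and its opposite as word models. -/

namespace Alg

open MulOpposite

variable (k : Type u) [Field k]

/-- The algebra map out of `Alg k` determined by elements satisfying the relations. -/
noncomputable def liftGen {B : Type*} [Ring B] [Algebra k B] (f : Fin 3 → B)
    (h₁ : f 0 * f 0 + f 1 * f 0 = 0) (h₂ : f 0 * f 2 = 0) (h₃ : f 2 * f 1 = 0) : Alg k →ₐ[k] B :=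
  RingQuot.liftAlgHom k ⟨FreeAlgebra.lift k f, by
    intro a b h
    cases h <;> simpa⟩

@[simp] lemma liftGen_gen {B : Type*} [Ring B] [Algebra k B] (f : Fin 3 → B)
    (h₁ : f 0 * f 0 + f 1 * f 0 = 0) (h₂ : f 0 * f 2 = 0) (h₃ : f 2 * f 1 = 0) (i : Fin 3) :
    liftGen k f h₁ h₂ h₃ (gen k i) = f i := by
  simp [liftGen, gen]

lemma adjoin_gen : Algebra.adjoin k (Set.range (gen k)) = ⊤ := by
  have h : Set.range (gen k) =
      RingQuot.mkAlgHom k (AlgRel k) '' Set.range (FreeAlgebra.ι k) := by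
    rw [← Set.range_comp]
    rfl
  rw [h, ← AlgHom.map_adjoin, FreeAlgebra.adjoin_range_ι, Algebra.map_top,
    AlgHom.range_eq_top]
  exact RingQuot.mkAlgHom_surjective k (AlgRel k)

/-- The augmentation. -/
noncomputable def augmentation : Alg k →ₐ[k] k :=
  liftGen k (fun _ => 0) (by simp) (by simp) (by simp)

/-- The action of the algebra on words in `x`, `z`, `y`, with `y x = - x x`. -/
noncomputable def wordAction : Alg k →ₐ[k] Module.End k (List (Fin 3) →₀ k) :=
  liftGen k ![letterMul 0 (-1 : k) 0, letterMul 0 (-1 : k) 2, letterMul 0 (-1 : k) 1]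
    (by
      have h := letterMul_two_zero (k := k) (e := 0) (l := -1) (by decide)
      have add_eq_zero {V : Type u} [AddCommGroup V] [Module k V] {p q : V}
          (hpq : q = (-1 : k) • p) : p + q = 0 := by simp [hpq]
      exact add_eq_zero (V := Module.End k (List (Fin 3) →₀ k)) h)
    letterMul_zero_one
    (letterMul_one_two (by decide))

/-- The opposite action of the algebra on words in `z`, `x`, `w = x + y`, with `z w = z x`. -/
noncomputable def wordActionOp : Alg k →ₐ[k] (Module.End k (List (Fin 3) →₀ k))ᵐᵒᵖ :=
  liftGen k ![op (letterMul 1 (1 : k) 1), op (letterMul 1 (1 : k) 2 - letterMul 1 (1 : k) 1),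
      op (letterMul 1 (1 : k) 0)]
    (by
      have h := letterMul_one_two (k := k) (e := 1) (l := 1) (by decide)
      have sum_eq_zero {B : Type u} [Ring B] {x w : B} (hxw : x * w = 0) :
          op x * op x + op (w - x) * op x = 0 := by
        rw [← op_mul, ← op_mul, ← op_add, mul_sub, hxw, zero_sub, add_neg_cancel, op_zero]
      exact sum_eq_zero h)
    (by
      change op _ * op _ = 0
      rw [← op_mul, letterMul_zero_one, op_zero])
    (by
      have h := letterMul_two_zero (k := k) (e := 1) (l := 1) (by decide)
      have mul_eq_zero {B : Type u} [Ring B] [Module k B] {z x w : B}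
          (hw : w * z = (1 : k) • (x * z)) : op z * op (w - x) = 0 := by
        rw [← op_mul, sub_mul, hw, one_smul, sub_self, op_zero]
      exact mul_eq_zero (B := Module.End k (List (Fin 3) →₀ k)) h)

lemma range_gen_swap : Set.range ![gen k 0, gen k 2, gen k 1] = Set.range (gen k) := by
  ext r
  constructor
  · rintro ⟨i, rfl⟩
    fin_cases i
    exacts [⟨0, rfl⟩, ⟨2, rfl⟩, ⟨1, rfl⟩]
  · rintro ⟨i, rfl⟩
    fin_cases i
    exacts [⟨0, rfl⟩, ⟨2, rfl⟩, ⟨1, rfl⟩]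

/-- The word model of the algebra with `b, c, d = x, z, y`. -/
noncomputable def wordModel : WordModel k (Alg k) where
  g := ![gen k 0, gen k 2, gen k 1]
  e := 0
  l := -1
  he := by decide
  hl := by simp
  g_zero_one := gen_xz k
  g_one_two := gen_zy k
  g_two_zero := by
    have h := gen_xx_add_yx k
    rw [add_comm, ← eq_neg_iff_add_eq_zero, ← neg_one_smul k] at h
    exact h
  adjoin_g := by
    rw [range_gen_swap, adjoin_gen]
  toEnd := wordAction k
  toEnd_g i := by
    fin_cases i
    exacts [liftGen_gen k _ _ _ _ 0, liftGen_gen k _ _ _ _ 2, liftGen_gen k _ _ _ _ 1]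
  ε := augmentation k
  ε_g i := by fin_cases i <;> simp [augmentation]

/-- The word model of the opposite algebra with `b, c, d = z, x, x + y`. -/
noncomputable def wordModelOp : WordModel k (Alg k)ᵐᵒᵖ where
  g := ![op (gen k 2), op (gen k 0), op (gen k 0 + gen k 1)]
  e := 1
  l := 1
  he := by decide
  hl := one_ne_zero
  g_zero_one := by simp [← op_mul, gen_xz]
  g_one_two := by simpa [← op_mul, ← op_add, add_mul] using gen_xx_add_yx k
  g_two_zero := by
    change op (gen k 2 * (gen k 0 + gen k 1)) = (1 : k) • op (gen k 2 * gen k 0)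
    rw [mul_add, gen_zy, add_zero, one_smul]
  adjoin_g := by
    set S := Algebra.adjoin k
      (Set.range ![op (gen k 2), op (gen k 0), op (gen k 0 + gen k 1)]) with hS
    have hg (i) : ![op (gen k 2), op (gen k 0), op (gen k 0 + gen k 1)] i ∈ S :=
      Algebra.subset_adjoin ⟨i, rfl⟩
    have h : Algebra.adjoin k (Set.range (gen k)) ≤ S.unop := by
      rw [Algebra.adjoin_le_iff]
      rintro _ ⟨i, rfl⟩
      have h0 : op (gen k 0) ∈ S := hg 1
      have h1 : op (gen k 0 + gen k 1) ∈ S := hg 2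
      have h2 : op (gen k 2) ∈ S := hg 0
      fin_cases i
      · exact h0
      · have := sub_mem h1 h0
        rwa [← op_sub, add_sub_cancel_left] at this
      · exact h2
    rw [adjoin_gen, top_le_iff] at h
    rw [eq_top_iff]
    intro r _
    have : r.unop ∈ S.unop := h ▸ Algebra.mem_top
    exact this
  toEnd := AlgHom.opComm (wordActionOp k)
  toEnd_g i := by
    fin_cases i
    · simp [wordActionOp]
    · simp [wordActionOp]
    · simp [wordActionOp]
      exact add_sub_cancel (G := Module.End k (List (Fin 3) →₀ k)) _ _
  ε := (AlgHom.opComm ((AlgEquiv.toOpposite k k).toAlgHom.comp (augmentation k)))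
  ε_g i := by fin_cases i <;> simp [augmentation]

lemma range_wordModel_g : Set.range (wordModel k).g = Set.range (gen k) :=
  range_gen_swap k

lemma finrank_grading_one : Module.finrank k (grading k 1) = 3 := by
  rw [grading, pow_one, ← range_wordModel_g, finrank_span_eq_card (wordModel k).linearIndependent_g]
  rfl

end Alg

theorem mainTheorem1 (k : Type u) [Field k] :
    IsKoszul (Alg.grading k) ∧
    leftGlobalDimension (Alg k) = 4 ∧
    rightGlobalDimension (Alg k) = 4 ∧
    Module.finrank k (Alg.grading k 1) = 3 ∧
    ¬ PositselskiConjecture k := by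
  have hK : IsKoszul (Alg.grading k) :=
    { nontrivial := (Alg.augmentation k).toRingHom.domain_nontrivial
      connected := pow_zero _
      diagonal := fun n j h => by
        have hW : (fun n => (Alg.wordModel k).annihilatorChain.W ^ n) = Alg.grading k := by
          funext n
          rw [Alg.grading, ← Alg.range_wordModel_g]
          rfl
        rw [← hW]
        exact (Alg.wordModel k).annihilatorChain.subsingleton_barHomology h }
  have hl : leftGlobalDimension (Alg k) = 4 :=
    (Alg.wordModel k).annihilatorChain.leftGlobalDimension_eq
  have hr : rightGlobalDimension (Alg k) = 4 :=
    (Alg.wordModelOp k).annihilatorChain.leftGlobalDimension_eq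
  have h3 := Alg.finrank_grading_one k
  refine ⟨hK, hl, hr, h3, fun h => ?_⟩
  have hfin : Module.Finite k (Alg.grading k 1) :=
    FiniteDimensional.of_finrank_pos (K := k) (V := Alg.grading k 1) (by rw [h3]; norm_num)
  have := h (Alg k) (Alg.grading k) hK hfin 4 hl hr
  omega
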